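/- **Setting.** Let $n,m\ge 1$, $p,q\ge 0$, $\sigma,\beta,\gamma>0$, let $\mathcal X,\mathcal Y$ be sets and let $x_1,\dots,x_n\in\mathcal X$, $y_1,\dots,y_n\in\mathcal Y$, $\tilde y_1,\dots,\tilde y_m\in\mathcal Y$. Write $\mathcal N(\,\cdot\,;\mu,S)$ for the Gaussian law or density. *Linear model.* Given feature maps $\phi:\mathcal X\to\mathbb R^p$, $\psi:\mathcal Y\to\mathbb R^q$, let $f(x)=w^T\phi(x)$, $g(y)=v^T\psi(y)$ with priors $w\sim\mathcal N(0,\gamma^2 I)$, $v\sim\mathcal N(0,\beta^2I)$. Let $\Phi,\Psi,\tilde\Psi$ be the matrices with columns $\phi(x_i)$, $\psi(y_i)$, $\psi(\tilde y_j)$. *Kernel model.* Given kernels $k$ on $\mathcal X$ and $\ell$ on $\mathcal Y$, let $f\sim\mathcal{GP}(0,k)$ and $g\sim\mathcal{GP}(0,\ell)$. Put $K=(k(x_i,x_j))$, $L=(\ell(y_i,y_j))$, $\tilde L=(\ell(y_i,\tilde y_j))$, $\tilde{\tilde L}=(\ell(\tilde y_i,\tilde y_j))$. *Transformed Bayesian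 regression* (TBLR/TBKR) with transformation $M\in\mathbb R^{n\times m}$ and noise covariance $\Sigma$ is the prior on $f$ together with the likelihood $p(\tilde z\mid f)=\mathcal N(\tilde z;M^T\mathbf f,\Sigma)$, $\mathbf f=(f(x_i))_{i}$. *Task-transformed Bayesian regression* (TTBLR/TTBKR) is the prior on $f$ together with the likelihood $p(\tilde z\mid f)=\int p(\tilde z\mid z)\,p(z\mid f)\,dz$, where $p(z\mid f)=\mathcal N(z;\mathbf f,0)$ is noise-free and $p(\tilde z\mid z)=\int p(\tilde z\mid g)\,p(g\mid z)\,dg$ is the predictive density of the regression for $g$ with $p(z\mid g)=\mathcal N(z;(g(y_i))_i,\sigma^2I)$, $p(\tilde z\mid g)=\mathcal N(\tilde z;(g(\tilde y_j))_j,\sigma^2I)$ and $p(g\mid z)$ given by Bayes' rule. *Approximating the posterior for $g$ by MAP* means using $p(\tilde z\mid z)=\mathcal N(\tilde z;\hat g(z),\sigma^2I)$, where $\hat g(z)=\tilde\Psi^T\hat v(z)$ with $\hat v(z)$ the mode of $p(v\mid z)$ in the linear model, and $\hat g(z)$ is the mode of the law of $(g(\tilde y_j))_j$ given $z$ in the kernel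 model. Here $u$ is a mode of a law $\mu$ if $\mu(B(u,r))/\sup_v\mu(B(v,r))\to1$ as $r\to0^+$ (for a bounded continuous density: $u$ is a global maximizer). For $\lambda,\epsilon$ define the *parametric DME estimator* $\bar f(x)=\bar w^T\phi(x)$, $\bar w=[\Phi AA^T\Phi^T+m\epsilon I]^{-1}\Phi A\tilde z$ with $A=\Psi^T(\Psi\Psi^T+n\lambda I)^{-1}\tilde\Psi$, and the *nonparametric DME estimator* $\bar f(x)=\sum_i\bar\alpha_ik(x_i,x)$, $\bar\alpha=A[A^TKA+m\epsilon I]^{-1}\tilde z$ with $A=(L+n\lambda I)^{-1}\tilde L$. *Task-transformed ridge regression* consists of the chained problems $$\hat v[w]=\operatorname*{argmin}_{v}\tfrac1n\sum_{i}\big(\langle w,\phi(x_i)\rangle-\langle v,\psi(y_i)\rangle\big)^2+\lambda\|v\|^2,\qquad \bar w=\operatorname*{argmin}_{w}\tfrac1m\sum_{j}\big(\tilde z_j-\langle\hat v[w],\psi(\tilde y_j)\rangle\big)^2+\epsilon\|w\|^2;$$ it is called TTLRR for features in $\mathbb R^p,\mathbb R^q$, and TTKRR for features in real inner product spaces with $\langle\phi(a),\phi(b)\rangle=k(a,b)$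 and $\langle\psi(a),\psi(b)\rangle=\ell(a,b)$. **Theorem.** (1) The TTBLR is the TBLR with $M=A:=\Psi^T(\Psi\Psi^T+\frac{\sigma^2}{\beta^2}I)^{-1}\tilde\Psi$ and $\Sigma=\sigma^2\tilde\Psi^T(\Psi\Psi^T+\frac{\sigma^2}{\beta^2}I)^{-1}\tilde\Psi+\sigma^2I$. (2) The TTBKR is the TBKR with $M=A:=(L+\sigma^2I)^{-1}\tilde L$ and $\Sigma=\tilde{\tilde L}+\sigma^2I-\tilde L^T(L+\sigma^2I)^{-1}\tilde L$. (3) With $A,\Sigma$ from (1), the TTBLR marginal likelihood is $p(\tilde z)=\mathcal N(\tilde z;0,[\Sigma^{-1}-\Sigma^{-1}A^T\Phi^TC\Phi A\Sigma^{-1}]^{-1})$, $C=[\Phi A\Sigma^{-1}A^T\Phi^T+\frac1{\gamma^2}I]^{-1}$. With $A,\Sigma$ from (2), the TTBKR marginal likelihood is $p(\tilde z)=\mathcal N(\tilde z;0,A^TKA+\Sigma)$. All matrices inverted or used as covariances in (1)–(3) are positive definite. (4) In both models MAP estimates for $g$ exist, and when the posterior for $g$ is approximated by MAP, the model becomes the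 transformed regression with the same $M=A$ and with $\Sigma=\sigma^2I$. For all $\tilde z$ and every query point, the mean of the posterior predictive law of the resulting TTBLR (resp. TTBKR) exists and is the parametric (resp. nonparametric) DME estimator with $\lambda=\frac{\sigma^2}{n\beta^2}$, $\epsilon=\frac{\sigma^2}{m\gamma^2}$ (resp. $\lambda=\frac{\sigma^2}n$, $\epsilon=\frac{\sigma^2}m$). The marginal likelihood of this TTBKR has the alternative form $p(\tilde z)=\mathcal N\big(\tilde z;0,\sigma^2[I-A^TB^{-1}KA]^{-1}\big)$, where $B=KAA^T+\sigma^2I$ is invertible and $I-A^TB^{-1}KA$ is positive definite. It can be evaluated using only an inverse and a determinant of the $n\times n$ matrix $B$: $$p(\tilde z)=\big((2\pi)^m\sigma^{2(m-n)}\det B\big)^{-1/2}\exp\Big(-\tfrac1{2\sigma^2}\big(\tilde z^T\tilde z-\tilde z^TA^TB^{-1}KA\tilde z\big)\Big).$$ (5) When the posteriors for both $g$ and $f$ are approximated by MAP, TTBLR and TTBKR become TTLRR and TTKRR with $\lambda,\epsilon$ from (4). In the linear model, with $\hat v(\cdot)$ the MAP estimate for $g$, a weight $w$ is the mode of $p(w\mid\tilde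 z)$ if and only if it solves the TTLRR problem with first-stage solution $\hat v[w']=\hat v(\Phi^Tw')$, if and only if $w=\bar w$ is the parametric DME weight. In the kernel model, for all finitely many query points the mode of the posterior of the values of $f$ there is given by the nonparametric DME estimator; for all feature maps realizing $k$ and $\ell$ in real inner product spaces, the TTKRR problem has a solution, each solution satisfies $\hat g\big((\langle w',\phi(x_i)\rangle)_i\big)=(\langle\hat v[w'],\psi(\tilde y_j)\rangle)_j$ for all $w'$ and $\bar w=\sum_i\bar\alpha_i\phi(x_i)$, and the mode of $f$ at query points $t_i$ is $(\langle\bar w,\phi(t_i)\rangle)_i$. -/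

import Mathlib

open MeasureTheory ProbabilityTheory Filter Topology
open scoped Matrix ENNReal

namespace TaskTransformed

/-- `ℝᵈ` with the Euclidean norm. -/
abbrev Vec (d : ℕ) : Type := EuclideanSpace ℝ (Fin d)

/-- The value `N(z ; μ, S)` at `z` of the Gaussian density with mean `μ` and (positive definite)
covariance `S`. -/
noncomputable def gaussPDF {d : ℕ} (μ : Vec d) (S : Matrix (Fin d) (Fin d) ℝ) (z : Vec d) : ℝ≥0∞ :=
  ENNReal.ofReal ((Real.sqrt ((2 * Real.pi) ^ d * S.det))⁻¹ *
    Real.exp (-(1 / 2) * ((z - μ).ofLp ⬝ᵥ (S⁻¹ *ᵥ (z - μ).ofLp))))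

/-! ### Random functions -/

/-- The values `(F (t₁), …, F (t_d))` of a random function at finitely many points. -/
noncomputable def evalAt {T Ω : Type*} {d : ℕ} (F : T → Ω → ℝ) (t : Fin d → T) (ω : Ω) : Vec d :=
  WithLp.toLp 2 fun i => F (t i) ω

/-- The linear model `t ↦ wᵀ φ(t)` with feature map `φ`, indexed by its weight vector `w`. -/
def linFun {T H : Type*} [NormedAddCommGroup H] [InnerProductSpace ℝ H] (φ : T → H) :
    T → H → ℝ :=
  fun t w => inner ℝ w (φ t)

/-- `F ~ GP(0, k)` under `P`. -/
structure IsCenteredGP {T Ω : Type*} [MeasurableSpace Ω] (k : T → T → ℝ) (F : T → Ω → ℝ)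
    (P : Measure Ω) : Prop where
  isGaussianProcess : IsGaussianProcess F P
  mean_eq_zero : ∀ t, ∫ ω, F t ω ∂P = 0
  cov_eq : ∀ s t, cov[F s, F t; P] = k s t

/-! ### Bayesian models -/

/-- Bayes' rule `p(ω | z) = p(z | ω) p(ω) / p(z)`, with `p(z) = ∫ p(z | ω) p(ω) dω`, for a fixed
observation `z` with likelihood function `lik = p(z | ·)` and prior `P`. -/
noncomputable def bayesPosterior {Ω : Type*} [MeasurableSpace Ω] (P : Measure Ω) (lik : Ω → ℝ≥0∞) :
    Measure Ω :=
  (∫⁻ ω, lik ω ∂P)⁻¹ • P.withDensity lik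

/-- A Bayesian model for an observation in `ℝᵐ`: a prior, and a likelihood `p(z | ω)`. -/
structure BayesModel (Ω : Type*) [MeasurableSpace Ω] (m : ℕ) where
  prior : Measure Ω
  likelihood : Ω → Vec m → ℝ≥0∞

namespace BayesModel

variable {Ω : Type*} [MeasurableSpace Ω] {m : ℕ}

/-- The marginal likelihood `p(z) = ∫ p(z | ω) p(ω) dω`. -/
noncomputable def evidence (B : BayesModel Ω m) (z : Vec m) : ℝ≥0∞ :=
  ∫⁻ ω, B.likelihood ω z ∂B.prior

/-- The posterior `p(ω | z)`. -/
noncomputable def posterior (B : BayesModel Ω m) (z : Vec m) : Measure Ω :=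
  bayesPosterior B.prior fun ω => B.likelihood ω z

/-- The posterior predictive law, given `z`, of the noise-free target `F(t)` at a query point. -/
noncomputable def predictive {T : Type*} (B : BayesModel Ω m) (F : T → Ω → ℝ) (t : T) (z : Vec m) :
    Measure ℝ :=
  (B.posterior z).map (F t)

end BayesModel

/-- `u` is a maximum a posteriori estimate (a mode) for the law `μ`: asymptotically no small ball
has more mass than the one around `u`. If `μ` has a bounded continuous Lebesgue density, this says
that `u` is a global maximizer of the density; the definition also makes sense for laws without a
density, such as a Gaussian with singular covariance. -/
def IsMAP {E : Type*} [PseudoMetricSpace E] [MeasurableSpace E] (μ : Measure E) (u : E) : Prop :=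
  Tendsto (fun r : ℝ => μ (Metric.ball u r) / ⨆ v, μ (Metric.ball v r)) (𝓝[>] 0) (𝓝 1)

/-! ### Transformed and task-transformed Bayesian regression

With `P = N(0, γ² I)` and `F = linFun φ` these are the linear models, with `F ~ GP(0, k)` under `P`
they are the kernel (Gaussian process) models. -/

/-- Transformed Bayesian regression: the likelihood is `p(z' | f) = N(z' ; Mᵀ f(x), S)`. -/
noncomputable def transformedModel {T Ω : Type*} [MeasurableSpace Ω] {n m : ℕ} (P : Measure Ω)
    (F : T → Ω → ℝ) (x : Fin n → T) (M : Matrix (Fin n) (Fin m) ℝ) (S : Matrix (Fin m) (Fin m) ℝ) :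
    BayesModel Ω m where
  prior := P
  likelihood ω z' := gaussPDF (WithLp.toLp 2 (Mᵀ *ᵥ (evalAt F x ω).ofLp)) S z'

/-- The posterior `p(g | z)` of the random function `G` given noisy targets `z` at `y`, with
likelihood `p(z | g) = N(z ; g(y), σ² I)`. -/
noncomputable def gPosterior {T Ω : Type*} [MeasurableSpace Ω] {n : ℕ} (P : Measure Ω)
    (G : T → Ω → ℝ) (y : Fin n → T) (σ : ℝ) (z : Vec n) : Measure Ω :=
  bayesPosterior P fun ω => gaussPDF (evalAt G y ω) (σ ^ 2 • 1) z

/-- The predictive density `p(z' | z) = ∫ p(z' | g) p(g | z) dg` of noisy targets `z'` at `y'`,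
given noisy targets `z` at `y`, with `p(z' | g) = N(z' ; g(y'), σ² I)`. -/
noncomputable def gPredictive {T Ω : Type*} [MeasurableSpace Ω] {n m : ℕ} (P : Measure Ω)
    (G : T → Ω → ℝ) (y : Fin n → T) (y' : Fin m → T) (σ : ℝ) (z : Vec n) (z' : Vec m) : ℝ≥0∞ :=
  ∫⁻ ω, gaussPDF (evalAt G y' ω) (σ ^ 2 • 1) z' ∂(gPosterior P G y σ z)

/-- The predictive density `p(z' | z) = N(z' ; ĝ(z), σ² I)` obtained when the posterior of
`g(y')` given `z` is replaced by a point estimate `ĝ(z)`. -/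
noncomputable def pointPredictive {n m : ℕ} (σ : ℝ) (g : Vec n → Vec m) (z : Vec n) (z' : Vec m) :
    ℝ≥0∞ :=
  gaussPDF (g z) (σ ^ 2 • 1) z'

/-- Task-transformed Bayesian regression: the predictive density `pred z z' = p(z' | z)` of the
regression for `g` is propagated through the noise-free likelihood `p(z | f) = N(z ; f(x), 0)`,
giving the likelihood `p(z' | f) = ∫ p(z' | z) p(z | f) dz`. -/
noncomputable def ttModel {T Ω : Type*} [MeasurableSpace Ω] {n m : ℕ} (P : Measure Ω)
    (F : T → Ω → ℝ) (x : Fin n → T) (pred : Vec n → Vec m → ℝ≥0∞) : BayesModel Ω m where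
  prior := P
  likelihood ω z' := ∫⁻ z, pred z z' ∂(multivariateGaussian (evalAt F x ω) 0)

/-! ### Matrices and deconditional mean embedding estimators -/

/-- The matrix whose columns are the features of the points `x`. -/
def featureMatrix {T : Type*} {d n : ℕ} (φ : T → Vec d) (x : Fin n → T) :
    Matrix (Fin d) (Fin n) ℝ :=
  Matrix.of fun a i => φ (x i) a

/-- The matrix `(k (sᵢ, tⱼ))ᵢⱼ`. -/
def gram {T : Type*} {n m : ℕ} (k : T → T → ℝ) (s : Fin n → T) (t : Fin m → T) :
    Matrix (Fin n) (Fin m) ℝ :=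
  Matrix.of fun i j => k (s i) (t j)

/-- The weights `w̄ = [Φ A Aᵀ Φᵀ + m ε I]⁻¹ Φ A z'`, `A = Ψᵀ (Ψ Ψᵀ + n lam I)⁻¹ Ψ'`, of the
parametric estimator `f̄(t) = w̄ᵀ φ(t)`. -/
noncomputable def parametricWeights {X Y : Type*} {n m p q : ℕ} (φ : X → Vec p) (ψ : Y → Vec q)
    (x : Fin n → X) (y : Fin n → Y) (y' : Fin m → Y) (lam ε : ℝ) (z' : Vec m) : Vec p :=
  let Φ : Matrix (Fin p) (Fin n) ℝ := featureMatrix φ x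
  let Ψ : Matrix (Fin q) (Fin n) ℝ := featureMatrix ψ y
  let Ψ' : Matrix (Fin q) (Fin m) ℝ := featureMatrix ψ y'
  let A : Matrix (Fin n) (Fin m) ℝ := Ψᵀ * (Ψ * Ψᵀ + ((n : ℝ) * lam) • 1)⁻¹ * Ψ'
  WithLp.toLp 2 (((Φ * A * Aᵀ * Φᵀ + ((m : ℝ) * ε) • 1)⁻¹ * Φ * A) *ᵥ z'.ofLp)

/-- The parametric estimator `f̄(t) = w̄ᵀ φ(t)`. -/
noncomputable def parametricDME {X Y : Type*} {n m p q : ℕ} (φ : X → Vec p) (ψ : Y → Vec q)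
    (x : Fin n → X) (y : Fin n → Y) (y' : Fin m → Y) (lam ε : ℝ) (z' : Vec m) (t : X) : ℝ :=
  inner ℝ (parametricWeights φ ψ x y y' lam ε z') (φ t)

/-- The weights `ᾱ = A [Aᵀ K A + m ε I]⁻¹ z'`, `A = (L + n lam I)⁻¹ L'`, of the nonparametric
estimator `f̄(t) = ∑ᵢ ᾱᵢ k(xᵢ, t)`. -/
noncomputable def nonparametricWeights {X Y : Type*} {n m : ℕ} (k : X → X → ℝ) (ℓ : Y → Y → ℝ)
    (x : Fin n → X) (y : Fin n → Y) (y' : Fin m → Y) (lam ε : ℝ) (z' : Vec m) : Fin n → ℝ :=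
  let K : Matrix (Fin n) (Fin n) ℝ := gram k x x
  let A : Matrix (Fin n) (Fin m) ℝ := (gram ℓ y y + ((n : ℝ) * lam) • 1)⁻¹ * gram ℓ y y'
  (A * (Aᵀ * K * A + ((m : ℝ) * ε) • 1)⁻¹) *ᵥ z'.ofLp

/-- The nonparametric estimator `f̄(t) = ∑ᵢ ᾱᵢ k(xᵢ, t)`. -/
noncomputable def nonparametricDME {X Y : Type*} {n m : ℕ} (k : X → X → ℝ) (ℓ : Y → Y → ℝ)
    (x : Fin n → X) (y : Fin n → Y) (y' : Fin m → Y) (lam ε : ℝ) (z' : Vec m) (t : X) : ℝ :=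
  ∑ i, nonparametricWeights k ℓ x y y' lam ε z' i * k (x i) t

/-! ### Task-transformed ridge regression -/

/-- The map `vhat` and the weight `w` solve the chained regularized least squares problems
`vhat[w'] = argmin_v (1/n) ∑ᵢ (⟪w', φ(xᵢ)⟫ - ⟪v, ψ(yᵢ)⟫)² + lam ‖v‖²` (for every `w'`) and
`w = argmin_w' (1/m) ∑ⱼ (z'ⱼ - ⟪vhat[w'], ψ(y'ⱼ)⟫)² + ε ‖w'‖²`.
For features in `ℝᵖ`, `ℝ^q` this is task-transformed linear ridge regression; for features in
inner product spaces that realize kernels `k`, `ℓ` (the kernel trick) it is task-transformed kernel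
ridge regression. -/
def IsTTRR {X Y H₁ H₂ : Type*} [NormedAddCommGroup H₁] [InnerProductSpace ℝ H₁]
    [NormedAddCommGroup H₂] [InnerProductSpace ℝ H₂] {n m : ℕ} (φ : X → H₁) (ψ : Y → H₂)
    (x : Fin n → X) (y : Fin n → Y) (y' : Fin m → Y) (lam ε : ℝ) (z' : Vec m)
    (vhat : H₁ → H₂) (w : H₁) : Prop :=
  (∀ w' : H₁, IsMinOn (fun v : H₂ =>
      (1 / n : ℝ) * ∑ i, (inner ℝ w' (φ (x i)) - inner ℝ v (ψ (y i))) ^ 2 + lam * ‖v‖ ^ 2)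
      Set.univ (vhat w')) ∧
  IsMinOn (fun w' : H₁ =>
      (1 / m : ℝ) * ∑ j, (z' j - inner ℝ (vhat w') (ψ (y' j))) ^ 2 + ε * ‖w'‖ ^ 2) Set.univ w

end TaskTransformed

open TaskTransformed

/-! Everything rests on one Gaussian conditioning computation. Two vectors U, V form a centred
Gaussian pair when their joint characteristic function is the exponential of a quadratic form
(`IsGaussianPair`); no density is required, so degenerate covariances are allowed. Suppose V is
observed through additive noise with positive definite covariance S. Writing the noise density as a
Fourier integral and exchanging integrals yields the Fourier transform of the unnormalized posterior
of U (`integral_cexp_mul_gaussReal`). At frequency zero it gives the evidence N(z; 0, Kvv + S)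
(`lintegral_gaussReal`); after normalization it is the characteristic function of a Gaussian with
mean Kuv (Kvv + S)⁻¹ z and the Schur complement as covariance (`posterior_map`).

The values of a Gaussian process at query points, paired with Mᵀ F(x), are such a pair, and a linear
model is the process with kernel γ² ⟪φ, φ⟫; both models therefore share the same proofs. The
noise-free likelihood is a Dirac mass, so the task-transformed likelihood is the predictive density
for g evaluated at z = F(x), a Gaussian with mean Aᵀ F(x). The feature-space formulas follow from
the kernel formulas by the push-through and Woodbury identities, and the n × n form of the evidence
by Sylvester's determinant identity.

A Gaussian law, even a degenerate one, has its mean as its only mode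
(`isMAP_multivariateGaussian_iff`); this follows from the Cameron–Martin formula. Hence MAP for g
gives the point estimate Aᵀ z, and the posterior mean and mode of f are the DME formulas. On the
ridge side, completing the square shows that each stage has a unique minimizer. Inserting the first
stage into the second gives a ridge problem with features ∑ᵢ Aᵢⱼ φ(xᵢ), whose solution has the same
weights (`isTTRR_iff`). -/

namespace TaskTransformed

/-! ### Gaussian densities and Gaussian Fourier integrals -/

/-- The centred Gaussian density with covariance `S`, as a real function on `ℝᵈ`. -/
noncomputable def gaussReal {d : ℕ} (S : Matrix (Fin d) (Fin d) ℝ) (y : Fin d → ℝ) : ℝ :=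
  (Real.sqrt ((2 * Real.pi) ^ d * S.det))⁻¹ * Real.exp (-(1 / 2) * (y ⬝ᵥ (S⁻¹ *ᵥ y)))

theorem gaussPDF_eq {d : ℕ} (μ : Vec d) (S : Matrix (Fin d) (Fin d) ℝ) (z : Vec d) :
    gaussPDF μ S z = ENNReal.ofReal (gaussReal S (z.ofLp - μ.ofLp)) := rfl

theorem gaussReal_nonneg {d : ℕ} (S : Matrix (Fin d) (Fin d) ℝ) (y : Fin d → ℝ) :
    0 ≤ gaussReal S y := by
  unfold gaussReal; positivity

theorem gaussReal_pos {d : ℕ} {S : Matrix (Fin d) (Fin d) ℝ} (hS : S.PosDef) (y : Fin d → ℝ) :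
    0 < gaussReal S y := by
  have := hS.det_pos
  unfold gaussReal; positivity

theorem continuous_gaussReal {d : ℕ} (S : Matrix (Fin d) (Fin d) ℝ) :
    Continuous (gaussReal S) := by
  unfold gaussReal; fun_prop

/-- A positive definite real matrix is a Gram matrix `Bᵀ B` with `B` invertible. -/
theorem exists_eq_transpose_mul_self {b : ℕ} {R : Matrix (Fin b) (Fin b) ℝ} (hR : R.PosDef) :
    ∃ B : Matrix (Fin b) (Fin b) ℝ, IsUnit B ∧ R = Bᵀ * B := by
  open scoped MatrixOrder Matrix.Norms.L2Operator in
  obtain ⟨B, hB, h⟩ := CStarAlgebra.isStrictlyPositive_iff_eq_star_mul_self.1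
    (Matrix.isStrictlyPositive_iff_posDef.2 hR)
  exact ⟨B, hB, by simpa [Matrix.star_eq_conjTranspose] using h⟩

/-- Factor R = Bᵀ B and substitute u = B s. The quadratic form becomes a sum of squares, the two
linear terms merge into one with complex coefficients βᵢ + i αᵢ, and the standard diagonal Gaussian
integral applies; the Jacobian |det B|⁻¹ supplies the determinant of R. -/
theorem integral_cexp_quadraticForm {b : ℕ} {R : Matrix (Fin b) (Fin b) ℝ} (hR : R.PosDef)
    (a c : Fin b → ℝ) :
    ∫ s : Fin b → ℝ, Complex.exp (-(1 / 2 : ℂ) * ((s ⬝ᵥ R *ᵥ s : ℝ) : ℂ) + ((c ⬝ᵥ s : ℝ) : ℂ)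
        + Complex.I * ((a ⬝ᵥ s : ℝ) : ℂ)) =
      ((Real.sqrt ((2 * Real.pi) ^ b / R.det) : ℝ) : ℂ) *
        Complex.exp ((1 / 2 : ℂ) * ((c ⬝ᵥ R⁻¹ *ᵥ c : ℝ) : ℂ)
          - (1 / 2 : ℂ) * ((a ⬝ᵥ R⁻¹ *ᵥ a : ℝ) : ℂ)
          + Complex.I * ((a ⬝ᵥ R⁻¹ *ᵥ c : ℝ) : ℂ)) := by
  obtain ⟨B, hB, rfl⟩ := exists_eq_transpose_mul_self hR
  have hBd : IsUnit B.det := (Matrix.isUnit_iff_isUnit_det B).1 hB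
  have hBd0 : B.det ≠ 0 := hBd.ne_zero
  have key : ∀ e s : Fin b → ℝ, e ⬝ᵥ s = ((B⁻¹)ᵀ *ᵥ e) ⬝ᵥ (B *ᵥ s) := fun e s => by
    rw [Matrix.mulVec_transpose, ← Matrix.dotProduct_mulVec, Matrix.mulVec_mulVec,
      Matrix.nonsing_inv_mul _ hBd, Matrix.one_mulVec]
  have inv : ∀ e f : Fin b → ℝ, e ⬝ᵥ (Bᵀ * B)⁻¹ *ᵥ f = ((B⁻¹)ᵀ *ᵥ e) ⬝ᵥ ((B⁻¹)ᵀ *ᵥ f) :=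
    fun e f => by
    rw [Matrix.mul_inv_rev, ← Matrix.mulVec_mulVec, Matrix.dotProduct_mulVec,
      ← Matrix.mulVec_transpose, Matrix.transpose_nonsing_inv]
  set α := (B⁻¹)ᵀ *ᵥ a
  set β := (B⁻¹)ᵀ *ᵥ c
  let f : (Fin b → ℝ) → ℂ := fun u =>
    Complex.exp (-(1 / 2 : ℂ) * ∑ i, (u i : ℂ) ^ 2 + ∑ i, ((β i : ℂ) + Complex.I * α i) * u i)
  have hf : Continuous f := by fun_prop
  have h1 : ∀ s : Fin b → ℝ, Complex.exp (-(1 / 2 : ℂ) * ((s ⬝ᵥ (Bᵀ * B) *ᵥ s : ℝ) : ℂ)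
      + ((c ⬝ᵥ s : ℝ) : ℂ) + Complex.I * ((a ⬝ᵥ s : ℝ) : ℂ)) = f (Matrix.toLin' B s) := by
    intro s
    have h2 : s ⬝ᵥ (Bᵀ * B) *ᵥ s = (B *ᵥ s) ⬝ᵥ (B *ᵥ s) := by
      rw [← Matrix.mulVec_mulVec, Matrix.dotProduct_mulVec, Matrix.vecMul_transpose]
    rw [h2, key c, key a]
    simp only [f, Matrix.toLin'_apply]
    congr 1
    simp only [dotProduct, Complex.ofReal_sum, Complex.ofReal_mul, add_mul,
      Finset.sum_add_distrib, Finset.mul_sum, pow_two, mul_assoc, add_assoc]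
    rfl
  simp_rw [h1]
  have hmeas : Measurable (Matrix.toLin' B) :=
    (LinearMap.continuous_of_finiteDimensional (Matrix.toLin' B)).measurable
  rw [← integral_map (μ := volume) (φ := Matrix.toLin' B) hmeas.aemeasurable
    hf.aestronglyMeasurable, Real.map_matrix_volume_pi_eq_smul_volume_pi hBd0,
    integral_smul_measure, ENNReal.toReal_ofReal (abs_nonneg _)]
  simp only [f]
  rw [GaussianFourier.integral_cexp_neg_mul_sum_add (by norm_num), inv, inv, inv]
  have h3 : ((Real.pi : ℂ) / (1 / 2)) ^ ((Fintype.card (Fin b) : ℂ) / 2) =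
      ((Real.sqrt ((2 * Real.pi) ^ b) : ℝ) : ℂ) := by
    rw [Real.sqrt_eq_rpow, ← Real.rpow_natCast, ← Real.rpow_mul (by positivity),
      Complex.ofReal_cpow (by positivity)]
    simp
    ring_nf
  have h4 : Real.sqrt ((2 * Real.pi) ^ b / (Bᵀ * B).det) =
      |B.det⁻¹| * Real.sqrt ((2 * Real.pi) ^ b) := by
    rw [Matrix.det_mul, Matrix.det_transpose, div_eq_inv_mul, mul_inv, Real.sqrt_mul (by
      rw [← mul_inv, ← pow_two]; positivity), Real.sqrt_mul_self_eq_abs]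
  rw [h3, h4, Complex.real_smul, Complex.ofReal_mul, mul_assoc]
  congr 3
  simp only [dotProduct, Complex.ofReal_sum, Complex.ofReal_mul, Finset.mul_sum,
    Finset.sum_div, ← Finset.sum_add_distrib, ← Finset.sum_sub_distrib]
  refine Finset.sum_congr rfl fun i _ => ?_
  linear_combination (1 / 2 * (α i : ℂ) ^ 2) * Complex.I_sq

/-- A non-integrable function has Bochner integral 0 by convention, whereas the closed form of this
integral is nonzero. -/
theorem integrable_exp_quadraticForm {b : ℕ} {R : Matrix (Fin b) (Fin b) ℝ} (hR : R.PosDef) :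
    Integrable fun s : Fin b → ℝ => Real.exp (-(1 / 2) * (s ⬝ᵥ R *ᵥ s)) := by
  have h := integral_cexp_quadraticForm hR 0 0
  have h0 : Integrable fun s : Fin b → ℝ =>
      Complex.exp (-(1 / 2 : ℂ) * ((s ⬝ᵥ R *ᵥ s : ℝ) : ℂ)) := by
    by_contra hc
    simp only [zero_dotProduct, Complex.ofReal_zero, mul_zero, add_zero, integral_undef hc] at h
    have h1 : 0 < Real.sqrt ((2 * Real.pi) ^ b / R.det) := by
      have := hR.det_pos
      positivity
    exact (mul_ne_zero (Complex.ofReal_ne_zero.2 h1.ne') (Complex.exp_ne_zero _)) h.symm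
  refine h0.norm.congr (ae_of_all _ fun s => ?_)
  simp only [Complex.norm_exp]
  congr 1
  simp

/-- Fourier inversion for the Gaussian density. -/
theorem gaussReal_eq_integral {b : ℕ} {S : Matrix (Fin b) (Fin b) ℝ} (hS : S.PosDef)
    (y : Fin b → ℝ) :
    ((gaussReal S y : ℝ) : ℂ) = (((2 * Real.pi) ^ b)⁻¹ : ℝ) * ∫ s : Fin b → ℝ,
      Complex.exp (-(1 / 2 : ℂ) * ((s ⬝ᵥ S *ᵥ s : ℝ) : ℂ) + Complex.I * ((y ⬝ᵥ s : ℝ) : ℂ)) := by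
  have h := integral_cexp_quadraticForm hS y 0
  simp only [zero_dotProduct, Complex.ofReal_zero, add_zero, Matrix.mulVec_zero, mul_zero,
    dotProduct_zero, zero_sub] at h
  rw [h, ← mul_assoc, ← Complex.ofReal_mul, gaussReal, Complex.ofReal_mul, Complex.ofReal_exp]
  have hd := hS.det_pos
  congr 1
  · congr 1
    have h2 : (0 : ℝ) < (2 * Real.pi) ^ b := by positivity
    rw [Real.sqrt_mul h2.le, Real.sqrt_div h2.le]
    nth_rewrite 2 [← Real.mul_self_sqrt h2.le]
    have := Real.sqrt_pos.2 h2
    have := Real.sqrt_pos.2 hd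
    field_simp
  · congr 1
    push_cast
    ring

/-! ### Gaussian pairs and the Fourier transform of the posterior -/

/-- `U` and `V` are jointly Gaussian and centred, with covariances `Kuu`, `Kuv`, `Kvv`. -/
structure IsGaussianPair {Ω : Type*} [MeasurableSpace Ω] {d b : ℕ} (P : Measure Ω)
    (U : Ω → Fin d → ℝ) (V : Ω → Fin b → ℝ) (Kuu : Matrix (Fin d) (Fin d) ℝ)
    (Kuv : Matrix (Fin d) (Fin b) ℝ) (Kvv : Matrix (Fin b) (Fin b) ℝ) : Prop where
  aemeasurable_left : AEMeasurable U P
  aemeasurable_right : AEMeasurable V P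
  symm_left : Kuuᵀ = Kuu
  symm_right : Kvvᵀ = Kvv
  integral_cexp : ∀ (t : Fin d → ℝ) (s : Fin b → ℝ),
    ∫ ω, Complex.exp (Complex.I * ((t ⬝ᵥ U ω + s ⬝ᵥ V ω : ℝ) : ℂ)) ∂P =
      Complex.exp (-(1 / 2 : ℂ) *
        ((t ⬝ᵥ Kuu *ᵥ t + 2 * (t ⬝ᵥ Kuv *ᵥ s) + s ⬝ᵥ Kvv *ᵥ s : ℝ) : ℂ))

namespace IsGaussianPair

variable {Ω : Type*} [MeasurableSpace Ω] {d b : ℕ} {P : Measure Ω} [IsProbabilityMeasure P]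
  {U : Ω → Fin d → ℝ} {V : Ω → Fin b → ℝ} {Kuu : Matrix (Fin d) (Fin d) ℝ}
  {Kuv : Matrix (Fin d) (Fin b) ℝ} {Kvv : Matrix (Fin b) (Fin b) ℝ}
  {S : Matrix (Fin b) (Fin b) ℝ}

/-- A characteristic function has modulus at most 1, so the exponent cannot have positive real part.
-/
theorem quadraticForm_nonneg (h : IsGaussianPair P U V Kuu Kuv Kvv) (t : Fin d → ℝ)
    (s : Fin b → ℝ) : 0 ≤ t ⬝ᵥ Kuu *ᵥ t + 2 * (t ⬝ᵥ Kuv *ᵥ s) + s ⬝ᵥ Kvv *ᵥ s := by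
  have h1 : ‖∫ ω, Complex.exp (Complex.I * ((t ⬝ᵥ U ω + s ⬝ᵥ V ω : ℝ) : ℂ)) ∂P‖ ≤ 1 := by
    refine (norm_integral_le_of_norm_le_const (C := 1) (ae_of_all _ fun ω => ?_)).trans (by simp)
    rw [mul_comm, Complex.norm_exp_ofReal_mul_I]
  rw [h.integral_cexp, Complex.norm_exp, Real.exp_le_one_iff, ← Complex.ofReal_one,
    ← Complex.ofReal_ofNat, ← Complex.ofReal_div, ← Complex.ofReal_neg, ← Complex.ofReal_mul,
    Complex.ofReal_re] at h1
  linarith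

theorem posSemidef_right (h : IsGaussianPair P U V Kuu Kuv Kvv) : Kvv.PosSemidef :=
  .of_dotProduct_mulVec_nonneg (by simpa [Matrix.IsSymm] using h.symm_right) fun s => by
    simpa using h.quadraticForm_nonneg 0 s

theorem posDef_add (h : IsGaussianPair P U V Kuu Kuv Kvv) (hS : S.PosDef) : (Kvv + S).PosDef :=
  .posSemidef_add h.posSemidef_right hS

/-- Evaluate the joint form at (t, -s) with s = (Kvv + S)⁻¹ Kuvᵀ t. Since s·Kvv s + s·S s = t·Kuv s,
the Schur form at t is this joint value plus s·S s, both nonnegative. -/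
theorem posSemidef_schur (h : IsGaussianPair P U V Kuu Kuv Kvv) (hS : S.PosDef) :
    (Kuu - Kuv * (Kvv + S)⁻¹ * Kuvᵀ).PosSemidef := by
  have hR := h.posDef_add hS
  have hRs : (Kvv + S)ᵀ = Kvv + S := hR.1
  refine .of_dotProduct_mulVec_nonneg ?_ fun t => ?_
  · simp only [Matrix.IsHermitian, Matrix.conjTranspose_eq_transpose_of_trivial,
      Matrix.transpose_sub, Matrix.transpose_mul, Matrix.transpose_nonsing_inv, hRs,
      h.symm_left, Matrix.transpose_transpose, Matrix.mul_assoc]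
  · set s := (Kvv + S)⁻¹ *ᵥ (Kuvᵀ *ᵥ t)
    have h1 := h.quadraticForm_nonneg t (-s)
    have h2 := hS.posSemidef.dotProduct_mulVec_nonneg s
    have h3 : s ⬝ᵥ Kvv *ᵥ s + s ⬝ᵥ S *ᵥ s = t ⬝ᵥ Kuv *ᵥ s := by
      rw [← dotProduct_add, ← Matrix.add_mulVec]
      have h4 : (Kvv + S) *ᵥ s = Kuvᵀ *ᵥ t := by
        simp only [s]
        rw [Matrix.mulVec_mulVec, Matrix.mul_nonsing_inv _ ((Matrix.isUnit_iff_isUnit_det _).1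
          hR.isUnit), Matrix.one_mulVec]
      rw [h4, dotProduct_comm, Matrix.dotProduct_mulVec t, ← Matrix.mulVec_transpose]
    simp only [star_trivial, Matrix.mulVec_neg, dotProduct_neg, neg_dotProduct, neg_neg,
      Matrix.sub_mulVec, dotProduct_sub] at h1 h2 ⊢
    rw [← Matrix.mulVec_mulVec, ← Matrix.mulVec_mulVec]
    change 0 ≤ _ - t ⬝ᵥ Kuv *ᵥ s
    linarith

/-- The Fourier transform of the unnormalized posterior. -/
theorem integral_cexp_mul_gaussReal (h : IsGaussianPair P U V Kuu Kuv Kvv) (hS : S.PosDef)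
    (z : Fin b → ℝ) (t : Fin d → ℝ) :
    ∫ ω, Complex.exp (Complex.I * ((t ⬝ᵥ U ω : ℝ) : ℂ)) * ((gaussReal S (z - V ω) : ℝ) : ℂ) ∂P =
      ((gaussReal (Kvv + S) z : ℝ) : ℂ) *
        Complex.exp (Complex.I * ((t ⬝ᵥ (Kuv * (Kvv + S)⁻¹) *ᵥ z : ℝ) : ℂ) -
          (1 / 2 : ℂ) * ((t ⬝ᵥ (Kuu - Kuv * (Kvv + S)⁻¹ * Kuvᵀ) *ᵥ t : ℝ) : ℂ)) := by
  have hR := h.posDef_add hS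
  have hRs : (Kvv + S)ᵀ = Kvv + S := hR.1
  have hU := h.aemeasurable_left
  have hV := h.aemeasurable_right
  simp_rw [gaussReal_eq_integral hS, mul_left_comm _ ((((2 * Real.pi) ^ b)⁻¹ : ℝ) : ℂ)]
  rw [integral_const_mul]
  have h0 : ∀ ω, Complex.exp (Complex.I * ((t ⬝ᵥ U ω : ℝ) : ℂ)) * ∫ s : Fin b → ℝ,
      Complex.exp (-(1 / 2 : ℂ) * ((s ⬝ᵥ S *ᵥ s : ℝ) : ℂ) +
        Complex.I * (((z - V ω) ⬝ᵥ s : ℝ) : ℂ)) =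
      ∫ s : Fin b → ℝ, Complex.exp (Complex.I * ((t ⬝ᵥ U ω : ℝ) : ℂ)) *
      Complex.exp (-(1 / 2 : ℂ) * ((s ⬝ᵥ S *ᵥ s : ℝ) : ℂ) +
        Complex.I * (((z - V ω) ⬝ᵥ s : ℝ) : ℂ)) := fun ω => (integral_const_mul _ _).symm
  simp_rw [h0]
  -- After Fubini the inner integral over Ω is the joint characteristic function at (t, -s). Its
  -- cross term gives a real linear term Kuvᵀ t in s, and Kvv adds to S, so the outer integral is
  -- again Gaussian.
  rw [integral_integral_swap]
  · have h1 : ∀ s : Fin b → ℝ, ∫ ω, Complex.exp (Complex.I * ((t ⬝ᵥ U ω : ℝ) : ℂ)) *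
        Complex.exp (-(1 / 2 : ℂ) * ((s ⬝ᵥ S *ᵥ s : ℝ) : ℂ) +
          Complex.I * (((z - V ω) ⬝ᵥ s : ℝ) : ℂ)) ∂P =
        Complex.exp (-(1 / 2 : ℂ) * ((t ⬝ᵥ Kuu *ᵥ t : ℝ) : ℂ)) *
        Complex.exp (-(1 / 2 : ℂ) * ((s ⬝ᵥ (Kvv + S) *ᵥ s : ℝ) : ℂ) +
          (((Kuvᵀ *ᵥ t) ⬝ᵥ s : ℝ) : ℂ) + Complex.I * ((z ⬝ᵥ s : ℝ) : ℂ)) := by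
      intro s
      have h2 : ∀ ω, Complex.exp (Complex.I * ((t ⬝ᵥ U ω : ℝ) : ℂ)) *
        Complex.exp (-(1 / 2 : ℂ) * ((s ⬝ᵥ S *ᵥ s : ℝ) : ℂ) +
          Complex.I * (((z - V ω) ⬝ᵥ s : ℝ) : ℂ)) =
          Complex.exp (-(1 / 2 : ℂ) * ((s ⬝ᵥ S *ᵥ s : ℝ) : ℂ) +
            Complex.I * ((z ⬝ᵥ s : ℝ) : ℂ)) *
          Complex.exp (Complex.I * ((t ⬝ᵥ U ω + (-s) ⬝ᵥ V ω : ℝ) : ℂ)) := by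
        intro ω
        rw [← Complex.exp_add, ← Complex.exp_add]
        congr 1
        rw [sub_dotProduct, neg_dotProduct, dotProduct_comm (V ω)]
        push_cast
        ring
      simp_rw [h2]
      rw [integral_const_mul, h.integral_cexp, ← Complex.exp_add, ← Complex.exp_add]
      congr 1
      have h3 : (Kuvᵀ *ᵥ t) ⬝ᵥ s = t ⬝ᵥ Kuv *ᵥ s := by
        rw [Matrix.mulVec_transpose, Matrix.dotProduct_mulVec]
      rw [h3]
      simp only [Matrix.mulVec_neg, dotProduct_neg, neg_dotProduct, neg_neg, Matrix.add_mulVec,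
        dotProduct_add]
      push_cast
      ring
    simp_rw [h1]
    rw [integral_const_mul, integral_cexp_quadraticForm hR]
    have h4 : (gaussReal (Kvv + S) z : ℂ) = (((2 * Real.pi) ^ b)⁻¹ : ℝ) *
        (((Real.sqrt ((2 * Real.pi) ^ b / (Kvv + S).det) : ℝ) : ℂ) *
          Complex.exp (-(1 / 2 : ℂ) * ((z ⬝ᵥ (Kvv + S)⁻¹ *ᵥ z : ℝ) : ℂ))) := by
      rw [gaussReal_eq_integral hR]
      have := integral_cexp_quadraticForm hR z 0
      simp only [zero_dotProduct, Complex.ofReal_zero, add_zero, Matrix.mulVec_zero, mul_zero,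
        dotProduct_zero, zero_sub, ← neg_mul] at this
      rw [this]
    rw [h4]
    have h5 : (Kuvᵀ *ᵥ t) ⬝ᵥ (Kvv + S)⁻¹ *ᵥ (Kuvᵀ *ᵥ t) =
        t ⬝ᵥ (Kuv * (Kvv + S)⁻¹ * Kuvᵀ) *ᵥ t := by
      rw [← Matrix.mulVec_mulVec, ← Matrix.mulVec_mulVec, Matrix.dotProduct_mulVec t,
        ← Matrix.mulVec_transpose]
    have h6 : z ⬝ᵥ (Kvv + S)⁻¹ *ᵥ (Kuvᵀ *ᵥ t) = t ⬝ᵥ (Kuv * (Kvv + S)⁻¹) *ᵥ z := by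
      rw [← Matrix.mulVec_mulVec, Matrix.dotProduct_mulVec t, ← Matrix.mulVec_transpose,
        Matrix.dotProduct_mulVec, ← Matrix.mulVec_transpose, Matrix.transpose_nonsing_inv, hRs,
        dotProduct_comm]
    rw [h5, h6, Matrix.sub_mulVec, dotProduct_sub]
    simp only [mul_assoc]
    congr 1
    rw [mul_left_comm]
    congr 1
    rw [← Complex.exp_add, ← Complex.exp_add]
    congr 1
    push_cast
    ring
  -- The phases have modulus 1, so the integrand on the product space is dominated by exp(-½ s·S s),
  -- which depends on s only; `P` is finite.
  · refine (Integrable.comp_snd (integrable_exp_quadraticForm hS) P).mono' ?_ ?_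
    · have hU' : AEMeasurable (fun x : Ω × (Fin b → ℝ) => U x.1) (P.prod volume) := hU.comp_fst
      have hV' : AEMeasurable (fun x : Ω × (Fin b → ℝ) => V x.1) (P.prod volume) := hV.comp_fst
      have hc : Continuous fun x : (Fin d → ℝ) × (Fin b → ℝ) × (Fin b → ℝ) =>
          Complex.exp (Complex.I * ((t ⬝ᵥ x.1 : ℝ) : ℂ)) *
          Complex.exp (-(1 / 2 : ℂ) * ((x.2.2 ⬝ᵥ S *ᵥ x.2.2 : ℝ) : ℂ) +
          Complex.I * (((z - x.2.1) ⬝ᵥ x.2.2 : ℝ) : ℂ)) := by fun_prop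
      exact (hc.measurable.comp_aemeasurable
        (hU'.prodMk (hV'.prodMk measurable_snd.aemeasurable))).aestronglyMeasurable
    · refine ae_of_all _ fun x => ?_
      simp only [Function.uncurry]
      rw [norm_mul, mul_comm Complex.I, Complex.norm_exp_ofReal_mul_I, one_mul, Complex.exp_add,
        norm_mul, mul_comm Complex.I, Complex.norm_exp_ofReal_mul_I, mul_one, Complex.norm_exp]
      apply le_of_eq
      congr 1
      simp

end IsGaussianPair

/-! ### Bayes' rule -/

section Bayes

variable {Ω : Type*} [MeasurableSpace Ω] {P : Measure Ω} {lik : Ω → ℝ≥0∞}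

theorem isProbabilityMeasure_bayesPosterior (h0 : ∫⁻ ω, lik ω ∂P ≠ 0) (h1 : ∫⁻ ω, lik ω ∂P ≠ ∞) :
    IsProbabilityMeasure (bayesPosterior P lik) where
  measure_univ := by
    simp [bayesPosterior, ENNReal.inv_mul_cancel h0 h1]

/-- Processes are only almost everywhere measurable under the prior; this carries that measurability
over to the posterior. -/
theorem bayesPosterior_absolutelyContinuous : bayesPosterior P lik ≪ P :=
  (Measure.smul_absolutelyContinuous).trans (withDensity_absolutelyContinuous P lik)

end Bayes

/-! ### Evidence and posterior of a Gaussian pair -/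

namespace IsGaussianPair

variable {Ω : Type*} [MeasurableSpace Ω] {d b : ℕ} {P : Measure Ω} [IsProbabilityMeasure P]
  {U : Ω → Fin d → ℝ} {V : Ω → Fin b → ℝ} {Kuu : Matrix (Fin d) (Fin d) ℝ}
  {Kuv : Matrix (Fin d) (Fin b) ℝ} {Kvv : Matrix (Fin b) (Fin b) ℝ}
  {S : Matrix (Fin b) (Fin b) ℝ}

theorem lintegral_gaussReal (h : IsGaussianPair P U V Kuu Kuv Kvv) (hS : S.PosDef)
    (z : Fin b → ℝ) :
    ∫⁻ ω, ENNReal.ofReal (gaussReal S (z - V ω)) ∂P =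
      ENNReal.ofReal (gaussReal (Kvv + S) z) := by
  have h1 := h.integral_cexp_mul_gaussReal hS z 0
  simp only [zero_dotProduct, Complex.ofReal_zero, mul_zero, Complex.exp_zero, one_mul, sub_zero,
    mul_one] at h1
  rw [integral_complex_ofReal, Complex.ofReal_inj] at h1
  have hpos := gaussReal_pos (h.posDef_add hS) z
  -- Without integrability the integral would be 0 by convention, but `h1` equates it with a
  -- positive density value.
  have hint : Integrable (fun ω => gaussReal S (z - V ω)) P := by
    by_contra hc
    rw [integral_undef hc] at h1
    exact hpos.ne h1
  rw [← h1, ofReal_integral_eq_lintegral_ofReal hint (ae_of_all _ fun ω => gaussReal_nonneg _ _)]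

theorem isProbabilityMeasure_posterior (h : IsGaussianPair P U V Kuu Kuv Kvv) (hS : S.PosDef)
    (z : Fin b → ℝ) :
    IsProbabilityMeasure
      (bayesPosterior P fun ω => ENNReal.ofReal (gaussReal S (z - V ω))) := by
  apply isProbabilityMeasure_bayesPosterior
  · rw [h.lintegral_gaussReal hS]
    simpa using gaussReal_pos (h.posDef_add hS) z
  · rw [h.lintegral_gaussReal hS]
    exact ENNReal.ofReal_ne_top

/-- The posterior law of one of two jointly Gaussian vectors given a noisy observation of the
other one. -/
theorem posterior_map (h : IsGaussianPair P U V Kuu Kuv Kvv) (hS : S.PosDef) (z : Fin b → ℝ) :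
    (bayesPosterior P fun ω => ENNReal.ofReal (gaussReal S (z - V ω))).map
        (fun ω => (WithLp.toLp 2 (U ω) : Vec d)) =
      multivariateGaussian (WithLp.toLp 2 ((Kuv * (Kvv + S)⁻¹) *ᵥ z))
        (Kuu - Kuv * (Kvv + S)⁻¹ * Kuvᵀ) := by
  have hU : AEMeasurable (fun ω => (WithLp.toLp 2 (U ω) : Vec d)) P :=
    (WithLp.measurable_toLp 2 _).comp_aemeasurable h.aemeasurable_left
  have hlik : AEMeasurable (fun ω => ENNReal.ofReal (gaussReal S (z - V ω))) P :=
    ((continuous_gaussReal S).measurable.comp_aemeasurable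
      (h.aemeasurable_right.const_sub z)).ennreal_ofReal
  have := h.isProbabilityMeasure_posterior hS z
  have hpos := gaussReal_pos (h.posDef_add hS) z
  apply Measure.ext_of_charFun
  ext t
  rw [charFun_multivariateGaussian (h.posSemidef_schur hS), charFun_apply,
    integral_map (hU.mono_ac bayesPosterior_absolutelyContinuous)
      (by fun_prop)]
  simp only [bayesPosterior]
  rw [integral_smul_measure, integral_withDensity_eq_integral_toReal_smul₀ hlik
    (ae_of_all _ fun _ => ENNReal.ofReal_lt_top), h.lintegral_gaussReal hS,
    ENNReal.toReal_inv, ENNReal.toReal_ofReal hpos.le]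
  have h1 := h.integral_cexp_mul_gaussReal hS z t.ofLp
  have h2 : ∀ ω, (ENNReal.ofReal (gaussReal S (z - V ω))).toReal •
      Complex.exp (((inner ℝ (WithLp.toLp 2 (U ω) : Vec d) t : ℝ) : ℂ) * Complex.I) =
      Complex.exp (Complex.I * ((t.ofLp ⬝ᵥ U ω : ℝ) : ℂ)) *
        ((gaussReal S (z - V ω) : ℝ) : ℂ) := fun ω => by
    rw [ENNReal.toReal_ofReal (gaussReal_nonneg _ _), Complex.real_smul, mul_comm]
    congr 2
    rw [mul_comm]
    congr 2
  simp_rw [h2]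
  rw [h1, Complex.real_smul, ← mul_assoc, ← Complex.ofReal_mul, inv_mul_cancel₀ hpos.ne',
    Complex.ofReal_one, one_mul]
  congr 1
  have h3 : inner ℝ t (WithLp.toLp 2 ((Kuv * (Kvv + S)⁻¹) *ᵥ z) : Vec d) =
      t.ofLp ⬝ᵥ (Kuv * (Kvv + S)⁻¹) *ᵥ z := by
    rw [EuclideanSpace.inner_eq_star_dotProduct, star_trivial, dotProduct_comm]
  rw [h3]
  ring

end IsGaussianPair

/-! ### Gaussian processes -/

/-- With an empty first component, the evidence formula for this pair says that a possibly
degenerate Gaussian convolved with N(0, S) has covariance C + S. This is how observation noise is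
added to a predictive law. -/
theorem isGaussianPair_multivariateGaussian {m : ℕ} (μ : Vec m) {C : Matrix (Fin m) (Fin m) ℝ}
    (hC : C.PosSemidef) :
    IsGaussianPair (multivariateGaussian μ C) (fun _ => (0 : Fin 0 → ℝ))
      (fun u => u.ofLp - μ.ofLp) 0 0 C where
  aemeasurable_left := by fun_prop
  aemeasurable_right := by fun_prop
  symm_left := by simp
  symm_right := hC.1
  integral_cexp t s := by
    have h := charFun_multivariateGaussian (μ := μ) hC (WithLp.toLp 2 s)
    rw [charFun_apply] at h
    have h1 : ∀ u : Vec m, Complex.exp (Complex.I *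
        ((t ⬝ᵥ (0 : Fin 0 → ℝ) + s ⬝ᵥ (u.ofLp - μ.ofLp) : ℝ) : ℂ)) =
        Complex.exp (-(((inner ℝ (WithLp.toLp 2 s : Vec m) μ : ℝ) : ℂ) * Complex.I)) *
        Complex.exp (((inner ℝ u (WithLp.toLp 2 s : Vec m) : ℝ) : ℂ) * Complex.I) := fun u => by
      rw [← Complex.exp_add]
      congr 1
      rw [EuclideanSpace.inner_eq_star_dotProduct, EuclideanSpace.inner_eq_star_dotProduct,
        dotProduct_sub, dotProduct_comm s μ.ofLp]
      simp
      ring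
    simp_rw [h1]
    rw [integral_const_mul, h, ← Complex.exp_add]
    congr 1
    simp
    ring

theorem multivariateGaussian_zero_cov {d : ℕ} (μ : Vec d) :
    multivariateGaussian μ (0 : Matrix (Fin d) (Fin d) ℝ) = Measure.dirac μ := by
  rw [multivariateGaussian]
  simp

namespace IsCenteredGP

variable {T Ω : Type*} [MeasurableSpace Ω] {k : T → T → ℝ} {F : T → Ω → ℝ} {P : Measure Ω}

theorem kernel_symm (h : IsCenteredGP k F P) (s t : T) : k s t = k t s := by
  rw [← h.cov_eq, ← h.cov_eq, covariance_comm]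

theorem gram_transpose (h : IsCenteredGP k F P) {n m : ℕ} (s : Fin n → T) (t : Fin m → T) :
    (gram k s t)ᵀ = gram k t s := by
  ext i j
  exact h.kernel_symm _ _

/-- A linear combination of process values is a real Gaussian with mean 0 whose variance is the
quadratic form of the kernel; evaluate its characteristic function at 1. -/
theorem integral_cexp [IsProbabilityMeasure P] (h : IsCenteredGP k F P) {ι : Type*} [Fintype ι]
    (t : ι → T) (a : ι → ℝ) :
    ∫ ω, Complex.exp (Complex.I * ((∑ i, a i * F (t i) ω : ℝ) : ℂ)) ∂P =
      Complex.exp (-(1 / 2 : ℂ) * ((∑ i, ∑ j, a i * (k (t i) (t j) * a j) : ℝ) : ℂ)) := by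
  obtain ⟨hgp, -, -⟩ := id h
  have hG : HasGaussianLaw (fun ω => ∑ i, a i * F (t i) ω) P :=
    ((hgp.comp_right t).smul a).hasGaussianLaw_fun_sum (I := Finset.univ)
  have hL : ∀ i, MemLp (F (t i)) 2 P := fun i =>
    (hgp.hasGaussianLaw_eval (t i)).memLp_two
  have hL' : ∀ i, MemLp (fun ω => a i * F (t i) ω) 2 P := fun i => (hL i).const_mul (a i)
  have hm : ∫ ω, ∑ i, a i * F (t i) ω ∂P = 0 := by
    rw [integral_finsetSum _ fun i _ => (hL' i).integrable one_le_two]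
    simp [integral_const_mul, h.mean_eq_zero]
  have hv : Var[fun ω => ∑ i, a i * F (t i) ω; P] = ∑ i, ∑ j, a i * (k (t i) (t j) * a j) := by
    rw [variance_fun_sum hL']
    refine Finset.sum_congr rfl fun i _ => Finset.sum_congr rfl fun j _ => ?_
    rw [covariance_const_mul_left, covariance_const_mul_right, h.cov_eq, mul_comm (a j)]
  have h1 := charFun_gaussianReal (μ := ∫ ω, ∑ i, a i * F (t i) ω ∂P)
    (v := (Var[fun ω => ∑ i, a i * F (t i) ω; P]).toNNReal) 1
  rw [← hG.map_eq_gaussianReal, charFun_apply_real, integral_map hG.aemeasurable (by fun_prop),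
    hm, hv, Real.coe_toNNReal _ (by rw [← hv]; exact variance_nonneg _ _)] at h1
  convert h1 using 2
  · ext ω
    congr 1
    push_cast
    ring
  · push_cast
    ring

theorem aemeasurable_evalAt (h : IsCenteredGP k F P) {d : ℕ} (t : Fin d → T) :
    AEMeasurable (evalAt F t) P := by
  obtain ⟨hgp, -, -⟩ := h
  exact (WithLp.measurable_toLp 2 _).comp_aemeasurable
    (aemeasurable_pi_lambda _ fun i => hgp.aemeasurable (t i))

/-- Since s·Mᵀ F(x) = (M s)·F(x), the characteristic function is that of the process at the
concatenated points (t, x) with coefficients (a, M s). -/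
theorem isGaussianPair [IsProbabilityMeasure P] (h : IsCenteredGP k F P) {d n m : ℕ}
    (t : Fin d → T) (x : Fin n → T) (M : Matrix (Fin n) (Fin m) ℝ) :
    IsGaussianPair P (fun ω => (evalAt F t ω).ofLp) (fun ω => Mᵀ *ᵥ (evalAt F x ω).ofLp)
      (gram k t t) (gram k t x * M) (Mᵀ * gram k x x * M) where
  aemeasurable_left := (WithLp.measurable_ofLp 2 _).comp_aemeasurable (h.aemeasurable_evalAt t)
  aemeasurable_right := by
    have hc : Continuous fun v : Vec n => Mᵀ *ᵥ v.ofLp := by fun_prop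
    exact hc.measurable.comp_aemeasurable (h.aemeasurable_evalAt x)
  symm_left := h.gram_transpose t t
  symm_right := by
    simp [Matrix.transpose_mul, h.gram_transpose, Matrix.mul_assoc]
  integral_cexp a s := by
    have h1 := h.integral_cexp (Sum.elim t x) (Sum.elim a (M *ᵥ s))
    simp only [Fintype.sum_sum_type, Sum.elim_inl, Sum.elim_inr] at h1
    refine (integral_congr_ae (ae_of_all _ fun ω => ?_)).trans (h1.trans ?_)
    · have h2 : s ⬝ᵥ Mᵀ *ᵥ (evalAt F x ω).ofLp = (M *ᵥ s) ⬝ᵥ (evalAt F x ω).ofLp := by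
        rw [Matrix.dotProduct_mulVec, Matrix.vecMul_transpose]
      simp only [h2]
      rfl
    · congr 3
      have h2 : s ⬝ᵥ (Mᵀ * gram k x x * M) *ᵥ s = (M *ᵥ s) ⬝ᵥ gram k x x *ᵥ (M *ᵥ s) := by
        rw [← Matrix.mulVec_mulVec, ← Matrix.mulVec_mulVec, Matrix.dotProduct_mulVec,
          Matrix.vecMul_transpose]
      have h3 : a ⬝ᵥ (gram k t x * M) *ᵥ s = (M *ᵥ s) ⬝ᵥ gram k x t *ᵥ a := by
        rw [← Matrix.mulVec_mulVec, Matrix.dotProduct_mulVec, ← Matrix.mulVec_transpose,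
          h.gram_transpose, dotProduct_comm]
      have h4 : a ⬝ᵥ (gram k t x * M) *ᵥ s = a ⬝ᵥ gram k t x *ᵥ (M *ᵥ s) := by
        rw [Matrix.mulVec_mulVec]
      rw [two_mul, h2]
      -- The two copies of the cross term must match the two off-diagonal blocks, so one is
      -- transposed and the other is not.
      nth_rewrite 2 [h3]
      rw [h4]
      simp only [dotProduct, Matrix.mulVec, gram, Matrix.of_apply, Finset.mul_sum,
        Finset.sum_add_distrib, add_assoc]

end IsCenteredGP

/-! ### Evidence, posterior and predictive laws of transformed regression -/

section Transformed

variable {T Ω : Type*} [MeasurableSpace Ω] {k : T → T → ℝ} {F : T → Ω → ℝ} {P : Measure Ω}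
  [IsProbabilityMeasure P] {n m : ℕ} {M : Matrix (Fin n) (Fin m) ℝ}
  {S : Matrix (Fin m) (Fin m) ℝ}

theorem IsCenteredGP.posDef_add (h : IsCenteredGP k F P) (x : Fin n → T)
    (M : Matrix (Fin n) (Fin m) ℝ) (hS : S.PosDef) : (Mᵀ * gram k x x * M + S).PosDef :=
  (h.isGaussianPair x x M).posDef_add hS

theorem transformedModel_evidence (h : IsCenteredGP k F P) (x : Fin n → T) (hS : S.PosDef)
    (z : Vec m) :
    (transformedModel P F x M S).evidence z = gaussPDF 0 (Mᵀ * gram k x x * M + S) z := by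
  rw [gaussPDF_eq, WithLp.ofLp_zero, sub_zero]
  exact (h.isGaussianPair x x M).lintegral_gaussReal hS z.ofLp

theorem transformedModel_posterior_map (h : IsCenteredGP k F P) (x : Fin n → T) (hS : S.PosDef)
    (z : Vec m) {d : ℕ} (t : Fin d → T) :
    ((transformedModel P F x M S).posterior z).map (evalAt F t) =
      multivariateGaussian
        (WithLp.toLp 2 ((gram k t x * M * (Mᵀ * gram k x x * M + S)⁻¹) *ᵥ z.ofLp))
        (gram k t t - gram k t x * M * (Mᵀ * gram k x x * M + S)⁻¹ * (gram k t x * M)ᵀ) :=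
  (h.isGaussianPair t x M).posterior_map hS z.ofLp

/-- A single query is a vector indexed by `Fin 1`; the coordinate projection carries its Gaussian
posterior to the predictive law, which yields integrability and the mean. -/
theorem transformedModel_predictive (h : IsCenteredGP k F P) (x : Fin n → T) (hS : S.PosDef)
    (z : Vec m) (t : T) :
    IsProbabilityMeasure ((transformedModel P F x M S).predictive F t z) ∧
      Integrable id ((transformedModel P F x M S).predictive F t z) ∧
      ∫ s, s ∂((transformedModel P F x M S).predictive F t z) =
        ∑ i, ((M * (Mᵀ * gram k x x * M + S)⁻¹) *ᵥ z.ofLp) i * k (x i) t := by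
  have h1 := transformedModel_posterior_map (M := M) h x hS z (fun _ : Fin 1 => t)
  have hac : (transformedModel P F x M S).posterior z ≪ P := bayesPosterior_absolutelyContinuous
  have h2 : (transformedModel P F x M S).predictive F t z =
      (((transformedModel P F x M S).posterior z).map (evalAt F fun _ : Fin 1 => t)).map
        (EuclideanSpace.proj (𝕜 := ℝ) (0 : Fin 1)) := by
    rw [AEMeasurable.map_map_of_aemeasurable (by fun_prop)
      ((h.aemeasurable_evalAt _).mono_ac hac)]
    rfl
  rw [h2, h1]
  refine ⟨Measure.isProbabilityMeasure_map (by fun_prop), ?_, ?_⟩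
  · rw [integrable_map_measure (by fun_prop) (by fun_prop)]
    exact IsGaussian.integrable_dual _ (EuclideanSpace.proj (𝕜 := ℝ) (0 : Fin 1))
  · rw [integral_map (by fun_prop) (by fun_prop),
      ContinuousLinearMap.integral_comp_comm _ IsGaussian.integrable_fun_id,
      integral_id_multivariateGaussian, Matrix.mul_assoc, ← Matrix.mulVec_mulVec]
    change ∑ i, k t (x i) * ((M * (Mᵀ * gram k x x * M + S)⁻¹) *ᵥ z.ofLp) i = _
    refine Finset.sum_congr rfl fun i _ => ?_
    rw [h.kernel_symm, mul_comm]

/-- The noise-free likelihood is a Dirac mass at F(x), so the integral over z only evaluates `pred`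
there. -/
theorem ttModel_eq_transformedModel (P : Measure Ω) (F : T → Ω → ℝ) (x : Fin n → T)
    {pred : Vec n → Vec m → ℝ≥0∞}
    (hpred : ∀ z z', pred z z' = gaussPDF (WithLp.toLp 2 (Mᵀ *ᵥ z.ofLp)) S z') :
    ttModel P F x pred = transformedModel P F x M S := by
  simp only [ttModel, transformedModel, BayesModel.mk.injEq, true_and]
  ext ω z'
  rw [multivariateGaussian_zero_cov, lintegral_dirac, hpred]

theorem gPosterior_eq (P : Measure Ω) (F : T → Ω → ℝ) (x : Fin n → T) (σ : ℝ) (z : Vec n) :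
    gPosterior P F x σ z = (transformedModel P F x (1 : Matrix (Fin n) (Fin n) ℝ)
      (σ ^ 2 • 1)).posterior z := by
  simp [gPosterior, BayesModel.posterior, transformedModel]

theorem posDef_sq_smul_one {σ : ℝ} (hσ : 0 < σ) (n : ℕ) :
    (σ ^ 2 • (1 : Matrix (Fin n) (Fin n) ℝ)).PosDef :=
  Matrix.PosDef.one.smul (by positivity)

theorem gPosterior_map (h : IsCenteredGP k F P) (x : Fin n → T) {σ : ℝ} (hσ : 0 < σ)
    (z : Vec n) {d : ℕ} (t : Fin d → T) :
    (gPosterior P F x σ z).map (evalAt F t) =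
      multivariateGaussian
        (WithLp.toLp 2 ((gram k t x * (gram k x x + σ ^ 2 • 1)⁻¹) *ᵥ z.ofLp))
        (gram k t t - gram k t x * (gram k x x + σ ^ 2 • 1)⁻¹ * gram k x t) := by
  rw [gPosterior_eq, transformedModel_posterior_map h x (posDef_sq_smul_one hσ n)]
  simp [h.gram_transpose]

theorem IsCenteredGP.posDef_gram_add (h : IsCenteredGP k F P) (x : Fin n → T) {σ : ℝ}
    (hσ : 0 < σ) : (gram k x x + σ ^ 2 • 1).PosDef := by
  simpa using h.posDef_add x 1 (posDef_sq_smul_one hσ n)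

theorem IsCenteredGP.posSemidef_schur (h : IsCenteredGP k F P) (x : Fin n → T) {σ : ℝ}
    (hσ : 0 < σ) (t : Fin m → T) :
    (gram k t t - gram k t x * (gram k x x + σ ^ 2 • 1)⁻¹ * gram k x t).PosSemidef := by
  simpa [h.gram_transpose] using
    (h.isGaussianPair t x 1).posSemidef_schur (posDef_sq_smul_one hσ n)

/-- The integrand depends on g only through its values at the new points. Their posterior law is
Gaussian, and averaging the noise density against it adds σ² I to the covariance. -/
theorem gPredictive_eq (h : IsCenteredGP k F P) (x : Fin n → T) {σ : ℝ} (hσ : 0 < σ)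
    (t : Fin m → T) (z : Vec n) (z' : Vec m) :
    gPredictive P F x t σ z z' =
      gaussPDF (WithLp.toLp 2 ((gram k t x * (gram k x x + σ ^ 2 • 1)⁻¹) *ᵥ z.ofLp))
        (gram k t t - gram k t x * (gram k x x + σ ^ 2 • 1)⁻¹ * gram k x t + σ ^ 2 • 1) z' := by
  have hac : gPosterior P F x σ z ≪ P := bayesPosterior_absolutelyContinuous
  have hmeas : Measurable fun u : Vec m => gaussPDF u (σ ^ 2 • 1) z' := by
    simp only [gaussPDF_eq]
    have := continuous_gaussReal (σ ^ 2 • (1 : Matrix (Fin m) (Fin m) ℝ))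
    fun_prop
  rw [gPredictive, ← lintegral_map' (f := fun u : Vec m => gaussPDF u (σ ^ 2 • 1) z')
    hmeas.aemeasurable ((h.aemeasurable_evalAt t).mono_ac hac), gPosterior_map h x hσ]
  set μ : Vec m := WithLp.toLp 2 ((gram k t x * (gram k x x + σ ^ 2 • 1)⁻¹) *ᵥ z.ofLp)
  have h1 := (isGaussianPair_multivariateGaussian μ
    (h.posSemidef_schur x hσ t)).lintegral_gaussReal (posDef_sq_smul_one hσ m)
    (z'.ofLp - μ.ofLp)
  rw [gaussPDF_eq, ← h1]
  simp only [gaussPDF_eq, sub_sub_sub_cancel_right]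

end Transformed

/-! ### Linear models -/

/-- Linear functions of a Gaussian weight vector form a Gaussian process. -/
theorem isCenteredGP_linFun {T : Type*} {p : ℕ} (φ : T → Vec p) (γ : ℝ) :
    IsCenteredGP (fun s t => γ ^ 2 * inner ℝ (φ s) (φ t)) (linFun φ)
      (multivariateGaussian (0 : Vec p) (γ ^ 2 • 1)) where
  isGaussianProcess := ⟨fun I => by
    have h := (HasGaussianLaw.mk (X := id) (P := multivariateGaussian (0 : Vec p) (γ ^ 2 • 1))
      (by rw [Measure.map_id]; infer_instance)).map
      (ContinuousLinearMap.pi fun i : I => innerSL ℝ (φ i))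
    have h1 : (fun w => I.restrict (linFun φ · w)) =
        (ContinuousLinearMap.pi fun i : I => innerSL ℝ (φ i)) ∘ id := by
      funext w i
      exact real_inner_comm (φ i) w
    rw [h1]
    exact h⟩
  mean_eq_zero t := by
    have h := (innerSL ℝ (φ t)).integral_comp_comm
      (IsGaussian.integrable_fun_id (μ := multivariateGaussian (0 : Vec p) (γ ^ 2 • 1)))
    rw [integral_id_multivariateGaussian, map_zero] at h
    rw [← h]
    exact integral_congr_ae (ae_of_all _ fun w => real_inner_comm (φ t) w)
  cov_eq s t := by
    have hS : (γ ^ 2 • (1 : Matrix (Fin p) (Fin p) ℝ)).PosSemidef :=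
      Matrix.PosSemidef.one.smul (sq_nonneg γ)
    have h := covarianceBilin_multivariateGaussian (μ := (0 : Vec p)) hS (φ s) (φ t)
    rw [covarianceBilin_apply_eq_cov IsGaussian.memLp_two_id] at h
    have h1 : ∀ r, linFun φ r = fun w => inner ℝ (φ r) w := fun r => by
      funext w
      exact real_inner_comm (φ r) w
    rw [h1, h1, h, Matrix.smul_mulVec, Matrix.one_mulVec, dotProduct_smul, smul_eq_mul,
      EuclideanSpace.inner_eq_star_dotProduct, star_trivial, dotProduct_comm]

/-! ### Modes of Gaussian laws -/

/-- Choose the preimage h orthogonal to ker L. Then ⟪h, z⟫ sees only the component of z orthogonal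
to ker L, and there L is injective, hence bounded below by finite dimensionality. The constant K
does not depend on h. -/
theorem exists_preimage_inner_le {E H : Type*} [NormedAddCommGroup E] [InnerProductSpace ℝ E]
    [FiniteDimensional ℝ E] [NormedAddCommGroup H] [InnerProductSpace ℝ H] (L : E →L[ℝ] H) : ∃ K : ℝ, 0 < K ∧ ∀ v ∈ L.toLinearMap.range,
    ∃ h, L h = v ∧ ∀ z, |inner ℝ h z| ≤ K * ‖h‖ * ‖L z‖ := by
  set N := L.toLinearMap.ker
  have hker : (L.toLinearMap.domRestrict Nᗮ).ker = ⊥ := by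
    rw [LinearMap.ker_eq_bot']
    rintro ⟨z, hz⟩ h0
    have h1 : z ∈ N := h0
    have h2 : inner ℝ z z = (0 : ℝ) := hz z h1
    exact Subtype.ext (inner_self_eq_zero.1 h2)
  obtain ⟨K, hK, hL⟩ := LinearMap.exists_antilipschitzWith _ hker
  have hproj : ∀ z, L (N.starProjection z) = 0 := fun z =>
    (N.starProjection_apply_mem z : N.starProjection z ∈ N)
  have hmem : ∀ z, z - N.starProjection z ∈ Nᗮ := fun z => N.sub_starProjection_mem_orthogonal z
  refine ⟨K, hK, ?_⟩
  rintro _ ⟨h, rfl⟩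
  refine ⟨h - N.starProjection h, by simp [hproj], fun z => ?_⟩
  have h1 : inner ℝ (h - N.starProjection h) z =
      inner ℝ (h - N.starProjection h) (z - N.starProjection z) := by
    rw [inner_sub_right, Submodule.inner_left_of_mem_orthogonal (N.starProjection_apply_mem z)
      (hmem h), sub_zero]
  have h2 : ‖z - N.starProjection z‖ ≤ K * ‖L z‖ := by
    have h3 := hL.le_mul_dist ⟨z - N.starProjection z, hmem z⟩ 0
    rw [map_zero, dist_zero_right, dist_zero_right] at h3
    simpa [LinearMap.domRestrict_apply, hproj] using h3
  rw [h1]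
  calc |inner ℝ (h - N.starProjection h) (z - N.starProjection z)|
      ≤ ‖h - N.starProjection h‖ * ‖z - N.starProjection z‖ := abs_real_inner_le_norm _ _
    _ ≤ ‖h - N.starProjection h‖ * (K * ‖L z‖) := by gcongr
    _ = _ := by ring

section StdGaussian

variable {E : Type*} [NormedAddCommGroup E] [InnerProductSpace ℝ E] [FiniteDimensional ℝ E]
  [MeasurableSpace E] [BorelSpace E]

/-- Both finite measures have the same characteristic function. -/
theorem stdGaussian_eq_withDensity : ∃ c : ℝ, 0 < c ∧ stdGaussian E =
    (volume : Measure E).withDensity fun x => ENNReal.ofReal (c * Real.exp (-(1 / 2) * ‖x‖ ^ 2)) := by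
  set c : ℝ := ((2 * Real.pi) ^ ((Module.finrank ℝ E : ℝ) / 2))⁻¹ with hc
  have hc0 : 0 < c := by positivity
  refine ⟨c, hc0, ?_⟩
  have hcont : Continuous fun x : E => c * Real.exp (-(1 / 2) * ‖x‖ ^ 2) := by fun_prop
  have hint : Integrable fun x : E => c * Real.exp (-(1 / 2) * ‖x‖ ^ 2) := by
    have h := (GaussianFourier.integrable_cexp_neg_mul_sq_norm_add (V := E) (b := (1 / 2 : ℂ))
      (by norm_num) 0 0).norm
    refine (h.congr (ae_of_all _ fun x => ?_)).const_mul c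
    simp only [Complex.norm_exp]
    congr 1
    have : (-(1 / 2 : ℂ) * (‖x‖ : ℂ) ^ 2 + 0 * ((inner ℝ (0 : E) x : ℝ) : ℂ)) =
        ((-(1 / 2) * ‖x‖ ^ 2 : ℝ) : ℂ) := by
      push_cast
      ring
    rw [this, Complex.ofReal_re]
  have : IsFiniteMeasure ((volume : Measure E).withDensity
      fun x => ENNReal.ofReal (c * Real.exp (-(1 / 2) * ‖x‖ ^ 2))) :=
    isFiniteMeasure_withDensity_ofReal hint.hasFiniteIntegral
  apply Measure.ext_of_charFun
  ext t
  rw [charFun_stdGaussian, charFun_apply, integral_withDensity_eq_integral_toReal_smul₀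
    (by fun_prop) (ae_of_all _ fun _ => ENNReal.ofReal_lt_top)]
  have h := GaussianFourier.integral_cexp_neg_mul_sq_norm_add (V := E) (b := (1 / 2 : ℂ))
      (by norm_num) Complex.I t
  have h1 : ∀ x : E, (ENNReal.ofReal (c * Real.exp (-(1 / 2) * ‖x‖ ^ 2))).toReal •
      Complex.exp (((inner ℝ x t : ℝ) : ℂ) * Complex.I) = (c : ℂ) *
      Complex.exp (-(1 / 2 : ℂ) * (‖x‖ : ℂ) ^ 2 + Complex.I * ((inner ℝ t x : ℝ) : ℂ)) := by
    intro x
    rw [ENNReal.toReal_ofReal (by positivity), Complex.real_smul, Complex.ofReal_mul, mul_assoc,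
      Complex.ofReal_exp, ← Complex.exp_add, real_inner_comm]
    congr 2
    push_cast
    ring
  simp_rw [h1]
  rw [integral_const_mul, h, ← mul_assoc]
  have h2 : (c : ℂ) * ((Real.pi : ℂ) / (1 / 2)) ^ ((Module.finrank ℝ E : ℂ) / 2) = 1 := by
    have h3 : ((Real.pi : ℂ) / (1 / 2)) ^ ((Module.finrank ℝ E : ℂ) / 2) =
        (((2 * Real.pi) ^ ((Module.finrank ℝ E : ℝ) / 2) : ℝ) : ℂ) := by
      rw [Complex.ofReal_cpow (by positivity)]
      push_cast
      congr 1
      ring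
    rw [h3, ← Complex.ofReal_mul, hc, inv_mul_cancel₀ (by positivity), Complex.ofReal_one]
  rw [h2, one_mul, Complex.I_sq]
  congr 1
  ring

/-- The Cameron–Martin formula for the standard Gaussian. -/
theorem stdGaussian_translate {A : Set E} (hA : MeasurableSet A) (h : E) :
    stdGaussian E {z | z - h ∈ A} =
      ∫⁻ z in A, ENNReal.ofReal (Real.exp (-inner ℝ h z - ‖h‖ ^ 2 / 2)) ∂(stdGaussian E) := by
  obtain ⟨c, hc, hd⟩ := stdGaussian_eq_withDensity (E := E)
  have hA' : MeasurableSet {z | z - h ∈ A} := (measurable_id.sub_const h) hA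
  have hm : Measurable fun x : E => ENNReal.ofReal (c * Real.exp (-(1 / 2) * ‖x‖ ^ 2)) := by
    fun_prop
  rw [hd, withDensity_apply _ hA', setLIntegral_withDensity_eq_setLIntegral_mul _ hm
    (by fun_prop) hA, ← lintegral_indicator hA', ← lintegral_indicator hA,
    ← lintegral_add_right_eq_self (μ := (volume : Measure E)) _ h]
  congr 1
  ext z
  by_cases hz : z ∈ A
  · rw [Set.indicator_of_mem (by simpa using hz), Set.indicator_of_mem hz, Pi.mul_apply,
      ← ENNReal.ofReal_mul (by positivity), mul_assoc, ← Real.exp_add, norm_add_sq_real,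
      real_inner_comm]
    congr 3
    ring
  · rw [Set.indicator_of_notMem (by simpa using hz), Set.indicator_of_notMem hz]

theorem stdGaussian_map_neg : (stdGaussian E).map (fun z => -z) = stdGaussian E :=
  stdGaussian_map (LinearIsometryEquiv.neg ℝ)

/-- A translate of a symmetric set on which the functional `⟪h, ·⟫` is bounded. -/
theorem stdGaussian_translate_le {A : Set E} (hA : MeasurableSet A) (hneg : ∀ z ∈ A, -z ∈ A) (h : E)
    {b : ℝ} (hb : ∀ z ∈ A, |inner ℝ h z| ≤ b) :
    stdGaussian E {z | z - h ∈ A} ≤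
      ENNReal.ofReal (Real.exp (-‖h‖ ^ 2 / 2 + b ^ 2 / 2)) * stdGaussian E A := by
  have h1 := stdGaussian_translate hA h
  have h2 := stdGaussian_translate hA (-h)
  have hA' : MeasurableSet {z | z - h ∈ A} := (measurable_id.sub_const h) hA
  -- By symmetry of A and of the Gaussian, the translates by h and -h have equal mass. Averaging the
  -- two Cameron–Martin densities replaces an exponential by cosh ⟪h, z⟫ ≤ exp(b²/2). The bound is
  -- quadratic in b, which is what makes the comparison of balls below uniform in h.
  have h3 : stdGaussian E {z | z - -h ∈ A} = stdGaussian E {z | z - h ∈ A} := by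
    conv_rhs => rw [← stdGaussian_map_neg]
    rw [Measure.map_apply measurable_neg hA']
    congr 1
    ext z
    simp only [Set.mem_ofPred_eq, Set.mem_preimage]
    constructor
    · intro hz
      simpa [sub_eq_add_neg, add_comm] using hneg _ hz
    · intro hz
      simpa [sub_eq_add_neg, add_comm] using hneg _ hz
  have h4 : 2 * stdGaussian E {z | z - h ∈ A} ≤
      2 * (ENNReal.ofReal (Real.exp (-‖h‖ ^ 2 / 2 + b ^ 2 / 2)) * stdGaussian E A) := by
    calc 2 * stdGaussian E {z | z - h ∈ A}
        = stdGaussian E {z | z - h ∈ A} + stdGaussian E {z | z - -h ∈ A} := by rw [h3, two_mul]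
      _ = ∫⁻ z in A, (ENNReal.ofReal (Real.exp (-inner ℝ h z - ‖h‖ ^ 2 / 2)) +
            ENNReal.ofReal (Real.exp (-inner ℝ (-h) z - ‖-h‖ ^ 2 / 2))) ∂(stdGaussian E) := by
          rw [h1, h2, ← lintegral_add_left (by fun_prop)]
      _ ≤ ∫⁻ _ in A, 2 * ENNReal.ofReal (Real.exp (-‖h‖ ^ 2 / 2 + b ^ 2 / 2))
            ∂(stdGaussian E) := by
          refine setLIntegral_mono' hA fun z hz => ?_
          rw [← ENNReal.ofReal_add (by positivity) (by positivity), ← ENNReal.ofReal_ofNat,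
            ← ENNReal.ofReal_mul (by norm_num)]
          apply ENNReal.ofReal_le_ofReal
          have hcosh := Real.cosh_le_exp_half_sq (inner ℝ h z)
          have hsq : (inner ℝ h z) ^ 2 ≤ b ^ 2 := by
            rw [← sq_abs]
            exact pow_le_pow_left₀ (abs_nonneg _) (hb z hz) 2
          rw [inner_neg_left, norm_neg, sub_eq_add_neg, sub_eq_add_neg, Real.exp_add, Real.exp_add,
            ← add_mul, neg_neg, neg_div, Real.exp_add, add_comm (Real.exp (-_))]
          have h5 : Real.exp (inner ℝ h z) + Real.exp (-inner ℝ h z) =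
              2 * Real.cosh (inner ℝ h z) := by
            rw [Real.cosh_eq]
            ring
          rw [h5, mul_comm (Real.exp (-_)), ← mul_assoc]
          gcongr
          exact hcosh.trans (Real.exp_le_exp.2 (by linarith))
      _ = _ := by
          rw [setLIntegral_const, mul_assoc]
  exact (ENNReal.mul_le_mul_iff_right (by norm_num) (by norm_num)).1 h4

instance : (stdGaussian E).IsOpenPosMeasure := by
  obtain ⟨c, hc, hd⟩ := stdGaussian_eq_withDensity (E := E)
  have h : (volume : Measure E) ≪ stdGaussian E := by
    rw [hd]
    refine withDensity_absolutelyContinuous' (by fun_prop) (ae_of_all _ fun x => ?_)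
    simpa using mul_pos hc (Real.exp_pos _)
  exact h.isOpenPosMeasure

variable {H : Type*} [NormedAddCommGroup H] [InnerProductSpace ℝ H]
  [MeasurableSpace H] [BorelSpace H]

/-- The mode of a possibly degenerate Gaussian law is its mean. -/
theorem isMAP_stdGaussian_map_iff (L : E →L[ℝ] H) (μ u : H) :
    IsMAP ((stdGaussian E).map fun z => μ + L z) u ↔ u = μ := by
  obtain ⟨K, hK, hpre⟩ := exists_preimage_inner_le L
  have hball : ∀ v r, ((stdGaussian E).map fun z => μ + L z) (Metric.ball v r) =
      stdGaussian E {z | ‖L z - (v - μ)‖ < r} := by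
    intro v r
    rw [Measure.map_apply (by fun_prop) measurableSet_ball]
    congr 1
    ext z
    simp only [Set.mem_preimage, Metric.mem_ball, dist_eq_norm, Set.mem_ofPred_eq]
    congr! 2
    abel
  have hmeas : ∀ r, MeasurableSet {z : E | ‖L z‖ < r} := fun r =>
    measurableSet_lt (by fun_prop) measurable_const
  have hrange : ∀ (h : E), (∀ z, |inner ℝ h z| ≤ K * ‖h‖ * ‖L z‖) → ∀ r : ℝ,
      stdGaussian E {z | ‖L z - L h‖ < r} ≤
        ENNReal.ofReal (Real.exp (-‖h‖ ^ 2 / 2 + (K * ‖h‖ * r) ^ 2 / 2)) *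
          stdGaussian E {z | ‖L z‖ < r} := by
    intro h hh r
    have := stdGaussian_translate_le (hmeas r) (by simp) h (b := K * ‖h‖ * r) fun z hz =>
      (hh z).trans (by have : ‖L z‖ < r := hz; gcongr)
    simpa using this
  set W := L.toLinearMap.range
  have hle : ∀ r : ℝ, 0 < r → K * r ≤ 1 → ∀ v,
      stdGaussian E {z | ‖L z - v‖ < r} ≤ stdGaussian E {z | ‖L z‖ < r} := by
    intro r hr hKr v
    -- Replacing the centre by its orthogonal projection onto the range of L only enlarges the
    -- event, since orthogonal projection does not increase norms.
    obtain ⟨h, hLh, hh⟩ := hpre (W.starProjection v) (W.starProjection_apply_mem v)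
    have h1 : {z | ‖L z - v‖ < r} ⊆ {z | ‖L z - L h‖ < r} := by
      intro z hz
      have hz' : ‖L z - v‖ < r := hz
      refine lt_of_le_of_lt (b := ‖L z - v‖) ?_ hz'
      have h2 : W.starProjection (L z) = L z :=
        W.starProjection_eq_self_iff.2 (LinearMap.mem_range_self L.toLinearMap z)
      rw [hLh]
      nth_rewrite 1 [← h2]
      rw [← map_sub]
      exact W.norm_starProjection_apply_le _
    refine (measure_mono h1).trans ((hrange h hh r).trans ?_)
    -- The exponent is -(‖h‖²/2)(1 - (K r)²), nonpositive for every h at once when K r ≤ 1. The ball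
    -- around the mean thus attains the supremum for all small r.
    have h3 : Real.exp (-‖h‖ ^ 2 / 2 + (K * ‖h‖ * r) ^ 2 / 2) ≤ 1 := by
      rw [Real.exp_le_one_iff]
      have h4 : (K * r) ^ 2 ≤ 1 := pow_le_one₀ (by positivity) hKr
      have h5 : (K * ‖h‖ * r) ^ 2 = ‖h‖ ^ 2 * (K * r) ^ 2 := by ring
      rw [h5]
      nlinarith [sq_nonneg ‖h‖]
    calc _ ≤ 1 * stdGaussian E {z | ‖L z‖ < r} := by
          gcongr
          exact ENNReal.ofReal_le_one.2 h3
      _ = _ := one_mul _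
  have hpos : ∀ r : ℝ, 0 < r → stdGaussian E {z | ‖L z‖ < r} ≠ 0 := fun r hr =>
    (IsOpen.measure_pos _ (isOpen_lt (by fun_prop) continuous_const)
      ⟨0, by simpa using hr⟩).ne'
  have hsup : ∀ r : ℝ, 0 < r → K * r ≤ 1 →
      ⨆ v, ((stdGaussian E).map fun z => μ + L z) (Metric.ball v r) =
        stdGaussian E {z | ‖L z‖ < r} := by
    intro r hr hKr
    refine le_antisymm (iSup_le fun v => ?_) (le_iSup_of_le μ ?_)
    · rw [hball]
      exact hle r hr hKr _
    · rw [hball]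
      simp
  have hev : ∀ᶠ r : ℝ in 𝓝[>] 0, 0 < r ∧ K * r ≤ 1 := by
    have h1 : ∀ᶠ r : ℝ in 𝓝[>] 0, 0 < r := eventually_mem_nhdsWithin
    have h2 : ∀ᶠ r : ℝ in 𝓝[>] 0, r < K⁻¹ :=
      nhdsWithin_le_nhds (eventually_lt_nhds (inv_pos.2 hK))
    filter_upwards [h1, h2] with r hr1 hr2
    refine ⟨hr1, ?_⟩
    calc K * r ≤ K * K⁻¹ := by gcongr
      _ = 1 := mul_inv_cancel₀ hK.ne'
  constructor
  · intro hmap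
    by_contra hne
    unfold IsMAP at hmap
    by_cases hv : u - μ ∈ W
    -- For a centre other than the mean within its translate of the range, the ratio of masses is at
    -- most exp(-‖h‖²/2 + O(r²)) with h ≠ 0, so it cannot tend to 1.
    · obtain ⟨h, hLh, hh⟩ := hpre _ hv
      have hh0 : h ≠ 0 := by
        rintro rfl
        exact hne (sub_eq_zero.1 (by simpa using hLh.symm))
      have hub : ∀ᶠ r : ℝ in 𝓝[>] 0,
          ((stdGaussian E).map fun z => μ + L z) (Metric.ball u r) /
            ⨆ v, ((stdGaussian E).map fun z => μ + L z) (Metric.ball v r) ≤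
          ENNReal.ofReal (Real.exp (-‖h‖ ^ 2 / 2 + (K * ‖h‖ * r) ^ 2 / 2)) := by
        filter_upwards [hev] with r hr
        rw [hsup r hr.1 hr.2, hball, ← hLh]
        exact ENNReal.div_le_of_le_mul (hrange h hh r)
      have hlim : Tendsto (fun r : ℝ =>
          ENNReal.ofReal (Real.exp (-‖h‖ ^ 2 / 2 + (K * ‖h‖ * r) ^ 2 / 2))) (𝓝[>] 0)
          (𝓝 (ENNReal.ofReal (Real.exp (-‖h‖ ^ 2 / 2 + (K * ‖h‖ * 0) ^ 2 / 2)))) := by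
        have hc : Continuous fun r : ℝ =>
          ENNReal.ofReal (Real.exp (-‖h‖ ^ 2 / 2 + (K * ‖h‖ * r) ^ 2 / 2)) :=
          ENNReal.continuous_ofReal.comp (by fun_prop)
        exact (hc.tendsto 0).mono_left nhdsWithin_le_nhds
      have h1 := le_of_tendsto_of_tendsto hmap hlim hub
      rw [ENNReal.one_le_ofReal, Real.one_le_exp_iff] at h1
      have : 0 < ‖h‖ ^ 2 := by positivity
      simp only [mul_zero] at h1
      linarith
    -- Otherwise the centre has positive distance from the support and small balls around it carry
    -- no mass.
    · have hd : 0 < ‖(u - μ) - W.starProjection (u - μ)‖ := by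
        rw [norm_pos_iff, sub_ne_zero]
        intro h0
        exact hv (W.starProjection_eq_self_iff.1 h0.symm)
      have hzero : (fun r : ℝ => ((stdGaussian E).map fun z => μ + L z) (Metric.ball u r) /
            ⨆ v, ((stdGaussian E).map fun z => μ + L z) (Metric.ball v r)) =ᶠ[𝓝[>] 0]
          fun _ => 0 := by
        filter_upwards [nhdsWithin_le_nhds (eventually_lt_nhds hd)] with r hr
        have h1 : {z | ‖L z - (u - μ)‖ < r} = ∅ := by
          ext z
          simp only [Set.mem_ofPred_eq, Set.mem_empty_iff_false, iff_false, not_lt]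
          refine hr.le.trans ?_
          rw [norm_sub_rev (L z), W.starProjection_minimal]
          exact ciInf_le ⟨0, by rintro _ ⟨y, rfl⟩; positivity⟩
            (⟨L z, LinearMap.mem_range_self L.toLinearMap z⟩ : W)
        rw [hball, h1]
        simp
      have h1 := tendsto_nhds_unique (hmap.congr' hzero) tendsto_const_nhds
      exact one_ne_zero h1
  · rintro rfl
    refine tendsto_const_nhds.congr' ?_
    filter_upwards [hev] with r hr
    rw [hsup r hr.1 hr.2, hball, sub_self]
    simp only [sub_zero]
    exact (ENNReal.div_self (hpos r hr.1) (measure_ne_top _ _)).symm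

end StdGaussian

theorem isMAP_multivariateGaussian_iff {d : ℕ} (μ u : Vec d) (C : Matrix (Fin d) (Fin d) ℝ) :
    IsMAP (multivariateGaussian μ C) u ↔ u = μ :=
  isMAP_stdGaussian_map_iff _ μ u

/-! ### Matrix identities -/

section Matrices

variable {a b : ℕ}

theorem _root_.Matrix.PosDef.isUnit_det' {S : Matrix (Fin a) (Fin a) ℝ} (hS : S.PosDef) :
    IsUnit S.det :=
  (Matrix.isUnit_iff_isUnit_det S).1 hS.isUnit

theorem posDef_smul_one {c : ℝ} (hc : 0 < c) : (c • (1 : Matrix (Fin a) (Fin a) ℝ)).PosDef :=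
  Matrix.PosDef.one.smul hc

theorem posDef_mul_transpose_add (B : Matrix (Fin a) (Fin b) ℝ) {c : ℝ} (hc : 0 < c) :
    (B * Bᵀ + c • 1).PosDef := by
  have h := Matrix.posSemidef_self_mul_conjTranspose B
  exact .posSemidef_add (by simpa using h) (posDef_smul_one hc)

theorem posDef_transpose_mul_add (B : Matrix (Fin a) (Fin b) ℝ) {c : ℝ} (hc : 0 < c) :
    (Bᵀ * B + c • 1).PosDef := by
  simpa using posDef_mul_transpose_add Bᵀ hc

/-- The push-through identity. -/
theorem transpose_mul_inv_push_through (B : Matrix (Fin a) (Fin b) ℝ) {c : ℝ} (hc : 0 < c) :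
    Bᵀ * (B * Bᵀ + c • 1)⁻¹ = (Bᵀ * B + c • 1)⁻¹ * Bᵀ := by
  have h1 := (posDef_mul_transpose_add B hc).isUnit_det'
  have h2 := (posDef_transpose_mul_add B hc).isUnit_det'
  have h3 : Bᵀ * (B * Bᵀ + c • 1) = (Bᵀ * B + c • 1) * Bᵀ := by
    simp [Matrix.mul_add, Matrix.add_mul, Matrix.mul_assoc]
  calc Bᵀ * (B * Bᵀ + c • 1)⁻¹
      = (Bᵀ * B + c • 1)⁻¹ * ((Bᵀ * B + c • 1) * Bᵀ) * (B * Bᵀ + c • 1)⁻¹ := by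
        rw [← Matrix.mul_assoc, Matrix.nonsing_inv_mul _ h2, Matrix.one_mul]
    _ = _ := by
        rw [← h3, Matrix.mul_assoc, Matrix.mul_assoc, Matrix.mul_nonsing_inv _ h1, Matrix.mul_one]

/-- With s the prior variance and t = σ², this moves the prior variance from the kernel into the
regularization constant t / s. -/
theorem smul_inv_smul_add {M : Matrix (Fin a) (Fin a) ℝ} {s t : ℝ} (hs : s ≠ 0)
    (hM : IsUnit (M + (t / s) • (1 : Matrix (Fin a) (Fin a) ℝ)).det) :
    s • (s • M + t • 1)⁻¹ = (M + (t / s) • 1)⁻¹ := by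
  have h1 : s • M + t • 1 = Units.mk0 s hs • (M + (t / s) • (1 : Matrix (Fin a) (Fin a) ℝ)) := by
    rw [Units.smul_def, Units.val_mk0, smul_add, smul_smul, mul_div_cancel₀ _ hs]
  rw [h1, Matrix.inv_smul' _ _ hM, Units.smul_def, smul_smul]
  simp [hs]

theorem mul_sub_mul_inv {R : Matrix (Fin a) (Fin a) ℝ} (c : ℝ)
    (hR : IsUnit (R + c • (1 : Matrix (Fin a) (Fin a) ℝ)).det) :
    1 - R * (R + c • 1)⁻¹ = c • (R + c • 1)⁻¹ := by
  have h1 := Matrix.mul_nonsing_inv _ hR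
  rw [Matrix.add_mul, Matrix.smul_mul, Matrix.one_mul] at h1
  exact sub_eq_of_eq_add (by rw [add_comm]; exact h1.symm)

/-- The Woodbury identity, for a positive semidefinite update. -/
theorem woodbury_inv {p n m : ℕ} (Φ : Matrix (Fin p) (Fin n) ℝ) (A : Matrix (Fin n) (Fin m) ℝ)
    {S : Matrix (Fin m) (Fin m) ℝ} (hS : S.PosDef) {c : ℝ} (hc : 0 < c) :
    (Φ * A * S⁻¹ * Aᵀ * Φᵀ + (1 / c) • 1).PosDef ∧
    (Aᵀ * (c • (Φᵀ * Φ)) * A + S)⁻¹ =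
      S⁻¹ - S⁻¹ * Aᵀ * Φᵀ * (Φ * A * S⁻¹ * Aᵀ * Φᵀ + (1 / c) • 1)⁻¹ * Φ * A * S⁻¹ := by
  have hD : (Φ * A * S⁻¹ * Aᵀ * Φᵀ + (1 / c) • 1).PosDef := by
    have h := hS.inv.posSemidef.mul_mul_conjTranspose_same (Φ * A)
    refine .posSemidef_add ?_ (posDef_smul_one (by positivity))
    simpa [Matrix.transpose_mul, Matrix.mul_assoc] using h
  refine ⟨hD, ?_⟩
  have hCi : (c • (1 : Matrix (Fin p) (Fin p) ℝ))⁻¹ = (1 / c) • 1 := by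
    apply Matrix.inv_eq_right_inv
    rw [Matrix.smul_mul, Matrix.one_mul, smul_smul, mul_one_div_cancel hc.ne', one_smul]
  have hV : Φ * A * S⁻¹ * (Aᵀ * Φᵀ) = Φ * A * S⁻¹ * Aᵀ * Φᵀ := by simp only [Matrix.mul_assoc]
  have h := Matrix.add_mul_mul_inv_eq_sub S (Aᵀ * Φᵀ) (c • (1 : Matrix (Fin p) (Fin p) ℝ)) (Φ * A)
    hS.isUnit (posDef_smul_one hc).isUnit (by rw [hCi, add_comm, hV]; exact hD.isUnit)
  rw [hCi, add_comm ((1 / c) • _), hV] at h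
  have h2 : Aᵀ * (c • (Φᵀ * Φ)) * A + S = 
      S + Aᵀ * Φᵀ * (c • (1 : Matrix (Fin p) (Fin p) ℝ)) * (Φ * A) := by
    rw [add_comm]
    simp [Matrix.mul_assoc]
  rw [h2, h]
  simp only [Matrix.mul_assoc]

/-! ### Identities for the evidence in terms of n × n matrices -/

section Evidence

variable {n m : ℕ} {K : Matrix (Fin n) (Fin n) ℝ} {A : Matrix (Fin n) (Fin m) ℝ} {c : ℝ}

/-- Sylvester's identity det(1 + X Y) = det(1 + Y X) after pulling out c; the factors c ^ m and c ^
n come from the two matrix sizes. -/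
theorem det_transpose_mul_mul_add (K : Matrix (Fin n) (Fin n) ℝ) (A : Matrix (Fin n) (Fin m) ℝ)
    (hc : 0 < c) :
    (Aᵀ * K * A + c • 1).det = c ^ m / c ^ n * (K * A * Aᵀ + c • 1).det := by
  have h1 : Aᵀ * K * A + c • 1 = c • (1 + Aᵀ * (c⁻¹ • (K * A))) := by
    rw [smul_add, Matrix.mul_smul, smul_smul, mul_inv_cancel₀ hc.ne', one_smul, Matrix.mul_assoc,
      add_comm]
  have h2 : K * A * Aᵀ + c • 1 = c • (1 + (c⁻¹ • (K * A)) * Aᵀ) := by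
    rw [smul_add, Matrix.smul_mul, smul_smul, mul_inv_cancel₀ hc.ne', one_smul, add_comm]
  rw [h1, h2, Matrix.det_smul, Matrix.det_smul, Matrix.det_one_add_mul_comm, Fintype.card_fin,
    Fintype.card_fin]
  field_simp

/-- K A Aᵀ need not be symmetric, so positivity arguments do not apply directly; invertibility is
transferred from the m × m matrix through the determinant. -/
theorem isUnit_mul_mul_transpose_add (hc : 0 < c) (hG : (Aᵀ * K * A + c • 1).PosDef) :
    IsUnit (K * A * Aᵀ + c • 1) := by
  have h := hG.det_pos
  rw [det_transpose_mul_mul_add K A hc] at h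
  rw [Matrix.isUnit_iff_isUnit_det, isUnit_iff_ne_zero]
  intro h0
  rw [h0, mul_zero] at h
  exact lt_irrefl _ h

/-- Put G = Aᵀ K A + c I and B = K A Aᵀ + c I. The intertwining K A G = B K A shows that the left
side times G equals G - Aᵀ K A = c I. -/
theorem one_sub_eq_smul_inv (hc : 0 < c) (hG : (Aᵀ * K * A + c • 1).PosDef) :
    1 - Aᵀ * (K * A * Aᵀ + c • 1)⁻¹ * K * A = c • (Aᵀ * K * A + c • 1)⁻¹ := by
  have hB := (Matrix.isUnit_iff_isUnit_det _).1 (isUnit_mul_mul_transpose_add hc hG)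
  have h1 : K * A * (Aᵀ * K * A + c • 1) = (K * A * Aᵀ + c • 1) * (K * A) := by
    simp [Matrix.mul_add, Matrix.add_mul, Matrix.mul_assoc]
  have h2 : (1 - Aᵀ * (K * A * Aᵀ + c • 1)⁻¹ * K * A) * (Aᵀ * K * A + c • 1) = c • 1 := by
    have h3 : Aᵀ * (K * A * Aᵀ + c • 1)⁻¹ * K * A * (Aᵀ * K * A + c • 1) = Aᵀ * K * A := by
      rw [Matrix.mul_assoc (Aᵀ * (K * A * Aᵀ + c • 1)⁻¹), Matrix.mul_assoc _ (K * A), h1,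
        Matrix.mul_assoc, ← Matrix.mul_assoc _ _ (K * A), Matrix.nonsing_inv_mul _ hB,
        Matrix.one_mul, Matrix.mul_assoc]
    rw [Matrix.sub_mul, Matrix.one_mul, h3, add_sub_cancel_left]
  calc _ = (1 - Aᵀ * (K * A * Aᵀ + c • 1)⁻¹ * K * A) * (Aᵀ * K * A + c • 1) *
        (Aᵀ * K * A + c • 1)⁻¹ :=
        (Matrix.mul_nonsing_inv_cancel_right _ _ hG.isUnit_det').symm
    _ = _ := by rw [h2, Matrix.smul_mul, Matrix.one_mul]

end Evidence

end Matrices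

/-! ### Features and kernels -/

theorem gram_const_mul_inner {T : Type*} {p n m : ℕ} (φ : T → Vec p) (c : ℝ) (s : Fin n → T)
    (t : Fin m → T) :
    gram (fun a b => c * inner ℝ (φ a) (φ b)) s t =
      c • ((featureMatrix φ s)ᵀ * featureMatrix φ t) := by
  ext i j
  simp [gram, featureMatrix, Matrix.mul_apply, PiLp.inner_apply, mul_comm]

theorem gram_inner {T : Type*} {p n m : ℕ} (φ : T → Vec p) (s : Fin n → T) (t : Fin m → T) :
    gram (fun a b => inner ℝ (φ a) (φ b)) s t = (featureMatrix φ s)ᵀ * featureMatrix φ t := by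
  simpa using gram_const_mul_inner φ 1 s t

theorem sum_smul_eq_featureMatrix_mulVec {T : Type*} {p n : ℕ} (φ : T → Vec p) (s : Fin n → T)
    (c : Fin n → ℝ) :
    ∑ i, c i • φ (s i) = WithLp.toLp 2 (featureMatrix φ s *ᵥ c) := by
  ext a
  simp [featureMatrix, Matrix.mulVec, dotProduct, mul_comm]

/-- The kernel trick for finite-dimensional features: the push-through identity is applied once to
Ψ, inside A, and once to Φ A. -/
theorem sum_nonparametricWeights_eq_parametricWeights {X Y : Type*} {n m p q : ℕ}
    (φ : X → Vec p) (ψ : Y → Vec q) (x : Fin n → X) (y : Fin n → Y) (y' : Fin m → Y)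
    {lam ε : ℝ} (hlam : 0 < n * lam) (hε : 0 < m * ε) (z' : Vec m) :
    ∑ i, nonparametricWeights (fun a b => inner ℝ (φ a) (φ b)) (fun a b => inner ℝ (ψ a) (ψ b))
      x y y' lam ε z' i • φ (x i) = parametricWeights φ ψ x y y' lam ε z' := by
  rw [sum_smul_eq_featureMatrix_mulVec]
  simp only [nonparametricWeights, parametricWeights, gram_inner]
  rw [transpose_mul_inv_push_through (featureMatrix ψ y) hlam,
    Matrix.mul_assoc _ (featureMatrix ψ y)ᵀ (featureMatrix ψ y')]
  set A := ((featureMatrix ψ y)ᵀ * featureMatrix ψ y + ((n : ℝ) * lam) • 1)⁻¹ *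
    ((featureMatrix ψ y)ᵀ * featureMatrix ψ y')
  set Φ := featureMatrix φ x
  have h := transpose_mul_inv_push_through (Φ * A)ᵀ hε
  rw [Matrix.transpose_transpose, Matrix.transpose_mul] at h
  have h1 : Aᵀ * (Φᵀ * Φ) * A = Aᵀ * Φᵀ * (Φ * A) := by simp only [Matrix.mul_assoc]
  have h2 : Φ * A * Aᵀ * Φᵀ = Φ * A * (Aᵀ * Φᵀ) := by simp only [Matrix.mul_assoc]
  rw [Matrix.mulVec_mulVec, h1, h2, ← Matrix.mul_assoc Φ A, h, Matrix.mul_assoc _ Φ A]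

/-! ### Ridge regression -/

section Ridge

variable {H : Type*} [NormedAddCommGroup H] [InnerProductSpace ℝ H]

/-- Completing the square: by the normal equation, the objective at w is its value at u plus a
nonnegative form in w - u that dominates lam ‖w - u‖². No completeness of the space is needed. -/
theorem isMinOn_ridge_iff_of_normal {n : ℕ} (χ : Fin n → H) (a : Fin n → ℝ) {c lam : ℝ}
    (hc : 0 ≤ c) (hlam : 0 < lam) {u : H}
    (hu : lam • u = c • ∑ i, (a i - inner ℝ u (χ i)) • χ i) (v : H) :
    IsMinOn (fun v : H => c * ∑ i, (a i - inner ℝ v (χ i)) ^ 2 + lam * ‖v‖ ^ 2) Set.univ v ↔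
      v = u := by
  have key : ∀ w : H, c * ∑ i, (a i - inner ℝ w (χ i)) ^ 2 + lam * ‖w‖ ^ 2 =
      (c * ∑ i, (a i - inner ℝ u (χ i)) ^ 2 + lam * ‖u‖ ^ 2) +
      (c * ∑ i, (inner ℝ (w - u) (χ i)) ^ 2 + lam * ‖w - u‖ ^ 2) := by
    intro w
    have h1 : lam * inner ℝ (w - u) u =
        c * ∑ i, (a i - inner ℝ u (χ i)) * inner ℝ (w - u) (χ i) := by
      have := congrArg (fun s => inner ℝ (w - u) s) hu
      simpa only [inner_smul_right, inner_sum] using this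
    have h2 : ‖w‖ ^ 2 = ‖w - u‖ ^ 2 + 2 * inner ℝ (w - u) u + ‖u‖ ^ 2 := by
      rw [← norm_add_sq_real, sub_add_cancel]
    have h3 : ∀ i, (a i - inner ℝ w (χ i)) ^ 2 = (a i - inner ℝ u (χ i)) ^ 2 +
        (inner ℝ (w - u) (χ i)) ^ 2 - 2 * ((a i - inner ℝ u (χ i)) * inner ℝ (w - u) (χ i)) := by
      intro i
      rw [inner_sub_left]
      ring
    simp_rw [h3]
    rw [Finset.sum_sub_distrib, Finset.sum_add_distrib, ← Finset.mul_sum, h2]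
    linear_combination 2 * h1
  constructor
  · intro h
    have h1 := h (Set.mem_univ u)
    simp only [Set.mem_ofPred_eq] at h1
    rw [key v] at h1
    have h2 : 0 ≤ c * ∑ i, (inner ℝ (v - u) (χ i)) ^ 2 := by positivity
    have h3 : lam * ‖v - u‖ ^ 2 ≤ 0 := by linarith
    have h4 : ‖v - u‖ ^ 2 ≤ 0 := nonpos_of_mul_nonpos_right h3 hlam
    have h5 : ‖v - u‖ = 0 := by
      exact pow_eq_zero_iff two_ne_zero |>.1 (le_antisymm h4 (sq_nonneg _))
    exact sub_eq_zero.1 (norm_eq_zero.1 h5)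
  · rintro rfl
    intro w _
    simp only [Set.mem_ofPred_eq]
    rw [key w]
    have h2 : 0 ≤ c * ∑ i, (inner ℝ (w - v) (χ i)) ^ 2 := by positivity
    have h3 : 0 ≤ lam * ‖w - v‖ ^ 2 := by positivity
    linarith

/-- The solution of the ridge regression problem in terms of the Gram matrix. -/
theorem isMinOn_ridge_iff {n : ℕ} (hn : 0 < n) (χ : Fin n → H) {G : Matrix (Fin n) (Fin n) ℝ}
    (hG : ∀ i j, G i j = inner ℝ (χ i) (χ j)) {lam : ℝ} (hlam : 0 < lam) (a : Fin n → ℝ) (v : H) :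
    IsMinOn (fun v : H => (1 / n : ℝ) * ∑ i, (a i - inner ℝ v (χ i)) ^ 2 + lam * ‖v‖ ^ 2)
      Set.univ v ↔ v = ∑ i, ((G + ((n : ℝ) * lam) • 1)⁻¹ *ᵥ a) i • χ i := by
  have hn' : (0 : ℝ) < n := Nat.cast_pos.2 hn
  have hGG : G = Matrix.gram ℝ χ := by
    ext i j
    rw [hG]
    rfl
  have hpd : (G + ((n : ℝ) * lam) • 1).PosDef :=
    .posSemidef_add (hGG ▸ Matrix.posSemidef_gram ℝ χ) (posDef_smul_one (by positivity))
  refine isMinOn_ridge_iff_of_normal χ a (by positivity) hlam ?_ v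
  set d := (G + ((n : ℝ) * lam) • 1)⁻¹ *ᵥ a
  have h1 : (G + ((n : ℝ) * lam) • 1) *ᵥ d = a := by
    rw [Matrix.mulVec_mulVec, Matrix.mul_nonsing_inv _ hpd.isUnit_det', Matrix.one_mulVec]
  have h2 : ∀ i, inner ℝ (∑ j, d j • χ j) (χ i) = (G *ᵥ d) i := by
    intro i
    simp only [sum_inner, real_inner_smul_left, Matrix.mulVec, dotProduct, hG]
    refine Finset.sum_congr rfl fun j _ => ?_
    rw [real_inner_comm, mul_comm]
  rw [Finset.smul_sum, Finset.smul_sum]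
  refine Finset.sum_congr rfl fun i _ => ?_
  rw [h2, smul_smul, smul_smul]
  congr 1
  have h3 := congrFun h1 i
  rw [Matrix.add_mulVec, Matrix.smul_mulVec, Matrix.one_mulVec, Pi.add_apply, Pi.smul_apply,
    smul_eq_mul] at h3
  rw [← h3]
  field_simp
  ring

variable {X Y H₁ H₂ : Type*} [NormedAddCommGroup H₁] [InnerProductSpace ℝ H₁]
  [NormedAddCommGroup H₂] [InnerProductSpace ℝ H₂] {n m : ℕ}

/-- The first-stage solution of task-transformed ridge regression. -/
noncomputable def firstStage (φ : X → H₁) (ψ : Y → H₂) (x : Fin n → X) (y : Fin n → Y) (lam : ℝ)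
    (w : H₁) : H₂ :=
  ∑ i, ((gram (fun a b => inner ℝ (ψ a) (ψ b)) y y + ((n : ℝ) * lam) • 1)⁻¹ *ᵥ
    (evalAt (linFun φ) x w).ofLp) i • ψ (y i)

theorem evalAt_sum_smul (ψ : Y → H₂) (y : Fin n → Y) (y' : Fin m → Y) (c : Fin n → ℝ) :
    evalAt (linFun ψ) y' (∑ i, c i • ψ (y i)) =
      WithLp.toLp 2 (gram (fun a b => inner ℝ (ψ a) (ψ b)) y' y *ᵥ c) := by
  ext j
  simp only [evalAt, linFun, sum_inner, real_inner_smul_left, gram, Matrix.mulVec, dotProduct,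
    Matrix.of_apply]
  refine Finset.sum_congr rfl fun i _ => ?_
  rw [real_inner_comm, mul_comm]

theorem gram_inner_transpose (ψ : Y → H₂) (y : Fin n → Y) (y' : Fin m → Y) :
    (gram (fun a b => inner ℝ (ψ a) (ψ b)) y y')ᵀ =
      gram (fun a b => inner ℝ (ψ a) (ψ b)) y' y := by
  ext i j
  exact real_inner_comm _ _

theorem evalAt_firstStage (φ : X → H₁) (ψ : Y → H₂) (x : Fin n → X) (y : Fin n → Y)
    (y' : Fin m → Y) (lam : ℝ) (w : H₁) :
    evalAt (linFun ψ) y' (firstStage φ ψ x y lam w) =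
      WithLp.toLp 2 (((gram (fun a b => inner ℝ (ψ a) (ψ b)) y y + ((n : ℝ) * lam) • 1)⁻¹ *
        gram (fun a b => inner ℝ (ψ a) (ψ b)) y y')ᵀ *ᵥ (evalAt (linFun φ) x w).ofLp) := by
  rw [firstStage, evalAt_sum_smul, Matrix.mulVec_mulVec, Matrix.transpose_mul,
    Matrix.transpose_nonsing_inv, Matrix.transpose_add, gram_inner_transpose,
    gram_inner_transpose, Matrix.transpose_smul, Matrix.transpose_one]

/-- The first stage is linear in w', and its prediction at y'ⱼ is ⟪w', χⱼ⟫ with χⱼ = ∑ᵢ Aᵢⱼ φ(xᵢ).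
So the second stage is an ordinary ridge problem in the features χ, with Gram matrix Aᵀ K A. -/
theorem isTTRR_iff (hn : 0 < n) (hm : 0 < m) (φ : X → H₁) (ψ : Y → H₂) (x : Fin n → X)
    (y : Fin n → Y) (y' : Fin m → Y) {lam ε : ℝ} (hlam : 0 < lam) (hε : 0 < ε) (z' : Vec m)
    (vhat : H₁ → H₂) (w : H₁) :
    IsTTRR φ ψ x y y' lam ε z' vhat w ↔
      (∀ w', vhat w' = firstStage φ ψ x y lam w') ∧
      w = ∑ i, nonparametricWeights (fun a b => inner ℝ (φ a) (φ b))
        (fun a b => inner ℝ (ψ a) (ψ b)) x y y' lam ε z' i • φ (x i) := by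
  unfold IsTTRR
  have h0 := forall_congr' fun w' => isMinOn_ridge_iff hn (fun i => ψ (y i))
    (G := gram (fun a b => inner ℝ (ψ a) (ψ b)) y y) (fun _ _ => rfl) hlam
    (fun i => inner ℝ w' (φ (x i))) (vhat w')
  refine (and_congr_left' h0).trans (and_congr_right fun hv => ?_)
  set A := (gram (fun a b => inner ℝ (ψ a) (ψ b)) y y + ((n : ℝ) * lam) • 1)⁻¹ *
        gram (fun a b => inner ℝ (ψ a) (ψ b)) y y' with hA
  let χ : Fin m → H₁ := fun j => ∑ i, A i j • φ (x i)
  have h1 : ∀ w' j, inner ℝ (vhat w') (ψ (y' j)) = inner ℝ w' (χ j) := by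
    intro w' j
    have h2 : evalAt (linFun ψ) y' (vhat w') = WithLp.toLp 2 (Aᵀ *ᵥ (evalAt (linFun φ) x w').ofLp) :=
      (congrArg _ (hv w')).trans (evalAt_firstStage φ ψ x y y' lam w')
    have h3 := congrArg (fun v : Vec m => v j) h2
    refine h3.trans ?_
    simp only [χ, inner_sum, inner_smul_right, Matrix.mulVec, dotProduct, Matrix.transpose_apply]
    rfl
  simp_rw [h1]
  have hG : ∀ i j, (Aᵀ * gram (fun a b => inner ℝ (φ a) (φ b)) x x * A) i j =
      inner ℝ (χ i) (χ j) := by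
    intro i j
    simp only [χ, inner_sum, sum_inner, real_inner_smul_left, inner_smul_right, Matrix.mul_apply,
      Matrix.transpose_apply, gram, Matrix.of_apply, Finset.sum_mul]
    refine Finset.sum_congr rfl fun r _ => ?_
    rw [Finset.mul_sum]
    refine Finset.sum_congr rfl fun s _ => ?_
    ring
  rw [isMinOn_ridge_iff hm χ hG hε (fun j => z' j) w]
  have h4 : ∀ d : Fin m → ℝ, ∑ j, d j • χ j = ∑ i, (A *ᵥ d) i • φ (x i) := by
    intro d
    simp only [χ, Finset.smul_sum, Matrix.mulVec, dotProduct, Finset.sum_smul, smul_smul]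
    rw [Finset.sum_comm]
    refine Finset.sum_congr rfl fun i _ => Finset.sum_congr rfl fun j _ => ?_
    rw [mul_comm]
  rw [h4, Matrix.mulVec_mulVec]
  rfl

end Ridge

/-! ### Linear models -/

section Linear

variable {T : Type*} {p q n m : ℕ}

/-- The posterior of the weights of a linear model. -/
theorem exists_linear_posterior_eq (φ : T → Vec p) (γ : ℝ) (x : Fin n → T)
    (M : Matrix (Fin n) (Fin m) ℝ) {S : Matrix (Fin m) (Fin m) ℝ} (hS : S.PosDef) (z : Vec m) :
    ∃ C, (transformedModel (multivariateGaussian (0 : Vec p) (γ ^ 2 • 1)) (linFun φ) x M S).posterior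
      z = multivariateGaussian (∑ i, (γ ^ 2 * ((M * (Mᵀ *
        gram (fun a b => γ ^ 2 * inner ℝ (φ a) (φ b)) x x * M + S)⁻¹) *ᵥ z.ofLp) i) • φ (x i)) C := by
  -- The process is indexed by the whole feature space, with identity features, so that the standard
  -- basis vectors are admissible queries; the values there are the weights themselves.
  have h := transformedModel_posterior_map (M := M) (isCenteredGP_linFun (id : Vec p → Vec p) γ)
    (φ ∘ x) hS z (fun a : Fin p => EuclideanSpace.single a (1 : ℝ))
  have h1 : evalAt (linFun (id : Vec p → Vec p)) (fun a : Fin p => EuclideanSpace.single a (1 : ℝ)) =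
      id := by
    funext w
    ext a
    simp [evalAt, linFun, EuclideanSpace.inner_single_right]
  rw [h1, Measure.map_id] at h
  refine ⟨_, h.trans (congrArg (multivariateGaussian · _) ?_)⟩
  ext a
  rw [Matrix.mul_assoc, ← Matrix.mulVec_mulVec]
  simp only [WithLp.ofLp_sum, WithLp.ofLp_smul, Finset.sum_apply, Pi.smul_apply, smul_eq_mul]
  change ∑ i, (γ ^ 2 * inner ℝ (EuclideanSpace.single a (1 : ℝ)) (φ (x i))) * _ = _
  refine Finset.sum_congr rfl fun i _ => ?_
  rw [EuclideanSpace.inner_single_left]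
  simp only [map_one, one_mul]
  rw [mul_right_comm]
  rfl

/-- The weight posterior is Gaussian, so its mode is its mean; absorbing β² turns that mean into the
ridge solution with regularizer σ² / β². -/
theorem gPosterior_linear_isMAP_iff (ψ : T → Vec q) {β σ : ℝ} (hβ : 0 < β) (hσ : 0 < σ)
    (y : Fin n → T) (z : Vec n) (v : Vec q) :
    IsMAP (gPosterior (multivariateGaussian (0 : Vec q) (β ^ 2 • 1)) (linFun ψ) y σ z) v ↔
      v = ∑ i, ((gram (fun a b => inner ℝ (ψ a) (ψ b)) y y + (σ ^ 2 / β ^ 2) • 1)⁻¹ *ᵥ z.ofLp) i •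
        ψ (y i) := by
  obtain ⟨C, hC⟩ := exists_linear_posterior_eq ψ β y 1 (posDef_sq_smul_one hσ n) z
  rw [gPosterior_eq, hC, isMAP_multivariateGaussian_iff]
  have hpd := posDef_transpose_mul_add (featureMatrix ψ y) (c := σ ^ 2 / β ^ 2) (by positivity)
  have h1 := smul_inv_smul_add (s := β ^ 2) (t := σ ^ 2) (by positivity) hpd.isUnit_det'
  rw [gram_const_mul_inner, gram_inner, ← h1]
  simp [Matrix.smul_mulVec]

theorem linear_transformation_eq_gram_inner (ψ : T → Vec q) {c : ℝ} (hc : 0 < c) (y : Fin n → T) (y' : Fin m → T) :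
    (featureMatrix ψ y)ᵀ * (featureMatrix ψ y * (featureMatrix ψ y)ᵀ + c • 1)⁻¹ *
        featureMatrix ψ y' =
      (gram (fun a b => inner ℝ (ψ a) (ψ b)) y y + c • 1)⁻¹ *
        gram (fun a b => inner ℝ (ψ a) (ψ b)) y y' := by
  rw [transpose_mul_inv_push_through _ hc, gram_inner, gram_inner, Matrix.mul_assoc]

/-- The transformation matrix of the linear model is the one of the kernel model for the kernel
`β² ⟪ψ, ψ⟫`. -/
theorem linear_transformation_eq (ψ : T → Vec q) {β σ : ℝ} (hβ : 0 < β) (hσ : 0 < σ)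
    (y : Fin n → T) (y' : Fin m → T) :
    (featureMatrix ψ y)ᵀ * (featureMatrix ψ y * (featureMatrix ψ y)ᵀ + (σ ^ 2 / β ^ 2) • 1)⁻¹ *
        featureMatrix ψ y' =
      (gram (fun a b => β ^ 2 * inner ℝ (ψ a) (ψ b)) y y + σ ^ 2 • 1)⁻¹ *
        gram (fun a b => β ^ 2 * inner ℝ (ψ a) (ψ b)) y y' := by
  have hpd := posDef_transpose_mul_add (featureMatrix ψ y) (c := σ ^ 2 / β ^ 2) (by positivity)
  have h1 := smul_inv_smul_add (s := β ^ 2) (t := σ ^ 2) (by positivity) hpd.isUnit_det'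
  rw [transpose_mul_inv_push_through _ (by positivity), gram_const_mul_inner,
    gram_const_mul_inner, ← h1, Matrix.mul_smul, Matrix.smul_mul, Matrix.smul_mul,
    Matrix.mul_assoc]

/-- The noise covariance of the linear model is the one of the kernel model for the kernel
`β² ⟪ψ, ψ⟫`. -/
theorem linear_covariance_eq (ψ : T → Vec q) {β σ : ℝ} (hβ : 0 < β) (hσ : 0 < σ)
    (y : Fin n → T) (y' : Fin m → T) :
    σ ^ 2 • ((featureMatrix ψ y')ᵀ * (featureMatrix ψ y * (featureMatrix ψ y)ᵀ +
        (σ ^ 2 / β ^ 2) • 1)⁻¹ * featureMatrix ψ y') + σ ^ 2 • 1 =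
      gram (fun a b => β ^ 2 * inner ℝ (ψ a) (ψ b)) y' y' + σ ^ 2 • 1 -
      (gram (fun a b => β ^ 2 * inner ℝ (ψ a) (ψ b)) y y')ᵀ *
        (gram (fun a b => β ^ 2 * inner ℝ (ψ a) (ψ b)) y y + σ ^ 2 • 1)⁻¹ *
        gram (fun a b => β ^ 2 * inner ℝ (ψ a) (ψ b)) y y' := by
  rw [Matrix.mul_assoc (gram _ y y')ᵀ, ← linear_transformation_eq ψ hβ hσ]
  set Ψ := featureMatrix ψ y
  set Ψ' := featureMatrix ψ y'
  -- The prior term minus the explained part, β² Ψ'ᵀ (I - Ψ Ψᵀ (Ψ Ψᵀ + c I)⁻¹) Ψ' with c = σ² / β²,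
  -- collapses because the bracket equals c (Ψ Ψᵀ + c I)⁻¹.
  have h1 := mul_sub_mul_inv (R := Ψ * Ψᵀ) (σ ^ 2 / β ^ 2)
    (posDef_mul_transpose_add Ψ (by positivity)).isUnit_det'
  set R := (Ψ * Ψᵀ + (σ ^ 2 / β ^ 2) • 1)⁻¹
  have h2 : σ ^ 2 • (Ψ'ᵀ * R * Ψ') = β ^ 2 • (Ψ'ᵀ * ((σ ^ 2 / β ^ 2) • R) * Ψ') := by
    rw [Matrix.mul_smul, Matrix.smul_mul, smul_smul, mul_div_cancel₀ _ (by positivity)]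
  rw [h2, ← h1, gram_const_mul_inner, gram_const_mul_inner, Matrix.mul_sub, Matrix.sub_mul,
    smul_sub, Matrix.transpose_smul, Matrix.transpose_mul, Matrix.transpose_transpose,
    Matrix.smul_mul, Matrix.mul_one]
  simp only [Matrix.mul_assoc]
  abel

end Linear

theorem sum_smul_eq_parametricWeights {X Y : Type*} {n m p q : ℕ} (hn : 0 < n) (hm : 0 < m)
    (φ : X → Vec p) (ψ : Y → Vec q) (x : Fin n → X) (y : Fin n → Y) (y' : Fin m → Y)
    {σ β γ : ℝ} (hσ : 0 < σ) (hβ : 0 < β) (hγ : 0 < γ) (z' : Vec m)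
    {A : Matrix (Fin n) (Fin m) ℝ} (hA : A = (featureMatrix ψ y)ᵀ *
      (featureMatrix ψ y * (featureMatrix ψ y)ᵀ + (σ ^ 2 / β ^ 2) • 1)⁻¹ * featureMatrix ψ y') :
    ∑ i, (γ ^ 2 * ((A * (Aᵀ * gram (fun a b => γ ^ 2 * inner ℝ (φ a) (φ b)) x x * A +
      σ ^ 2 • 1)⁻¹) *ᵥ z'.ofLp) i) • φ (x i) =
      parametricWeights φ ψ x y y' (σ ^ 2 / (n * β ^ 2)) (σ ^ 2 / (m * γ ^ 2)) z' := by
  have hn' : (0 : ℝ) < n := Nat.cast_pos.2 hn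
  have hm' : (0 : ℝ) < m := Nat.cast_pos.2 hm
  rw [← sum_nonparametricWeights_eq_parametricWeights φ ψ x y y' (by positivity) (by positivity)]
  have h1 : (n : ℝ) * (σ ^ 2 / (n * β ^ 2)) = σ ^ 2 / β ^ 2 := by field_simp
  have h2 : (m : ℝ) * (σ ^ 2 / (m * γ ^ 2)) = σ ^ 2 / γ ^ 2 := by field_simp
  rw [linear_transformation_eq_gram_inner ψ (by positivity)] at hA
  refine Finset.sum_congr rfl fun i _ => ?_
  congr 1
  simp only [nonparametricWeights]
  rw [h1, h2, ← hA, gram_inner, gram_const_mul_inner]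
  have hpd : (Aᵀ * ((featureMatrix φ x)ᵀ * featureMatrix φ x) * A + (σ ^ 2 / γ ^ 2) • 1).PosDef := by
    have h := posDef_transpose_mul_add (featureMatrix φ x * A) (c := σ ^ 2 / γ ^ 2) (by positivity)
    simpa [Matrix.transpose_mul, Matrix.mul_assoc] using h
  have h3 := smul_inv_smul_add (s := γ ^ 2) (t := σ ^ 2) (by positivity) hpd.isUnit_det'
  rw [← h3, Matrix.mul_smul, Matrix.mul_smul, Matrix.smul_mul, Matrix.smul_mulVec, Pi.smul_apply,
    smul_eq_mul]

/-! ### The linear model with the MAP estimate for `g` -/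

section LinearModel

variable {X Y : Type*} {n m p q : ℕ} (hn : 0 < n) (hm : 0 < m)
  (φ : X → Vec p) (ψ : Y → Vec q) (x : Fin n → X) (y : Fin n → Y) (y' : Fin m → Y)
  {σ β γ : ℝ} (hσ : 0 < σ) (hβ : 0 < β) (hγ : 0 < γ)
  {A : Matrix (Fin n) (Fin m) ℝ} (hA : A = (featureMatrix ψ y)ᵀ *
    (featureMatrix ψ y * (featureMatrix ψ y)ᵀ + (σ ^ 2 / β ^ 2) • 1)⁻¹ * featureMatrix ψ y')

include hn hm hσ hβ hγ hA

theorem linear_predictive (z' : Vec m) (t : X) :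
    IsProbabilityMeasure ((transformedModel (multivariateGaussian (0 : Vec p) (γ ^ 2 • 1))
      (linFun φ) x A (σ ^ 2 • 1)).predictive (linFun φ) t z') ∧
    Integrable id ((transformedModel (multivariateGaussian (0 : Vec p) (γ ^ 2 • 1))
      (linFun φ) x A (σ ^ 2 • 1)).predictive (linFun φ) t z') ∧
    ∫ s, s ∂((transformedModel (multivariateGaussian (0 : Vec p) (γ ^ 2 • 1))
      (linFun φ) x A (σ ^ 2 • 1)).predictive (linFun φ) t z') =
      parametricDME φ ψ x y y' (σ ^ 2 / (n * β ^ 2)) (σ ^ 2 / (m * γ ^ 2)) z' t := by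
  obtain ⟨h1, h2, h3⟩ := transformedModel_predictive (M := A) (isCenteredGP_linFun φ γ) x
    (posDef_sq_smul_one hσ m) z' t
  refine ⟨h1, h2, h3.trans ?_⟩
  rw [parametricDME, ← sum_smul_eq_parametricWeights hn hm φ ψ x y y' hσ hβ hγ z' hA, sum_inner]
  refine Finset.sum_congr rfl fun i _ => ?_
  rw [real_inner_smul_left]
  ring

theorem linear_posterior_isMAP_iff (z' : Vec m) (w : Vec p) :
    IsMAP ((transformedModel (multivariateGaussian (0 : Vec p) (γ ^ 2 • 1))
      (linFun φ) x A (σ ^ 2 • 1)).posterior z') w ↔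
      w = parametricWeights φ ψ x y y' (σ ^ 2 / (n * β ^ 2)) (σ ^ 2 / (m * γ ^ 2)) z' := by
  obtain ⟨C, hC⟩ := exists_linear_posterior_eq φ γ x A (posDef_sq_smul_one hσ m) z'
  rw [hC, isMAP_multivariateGaussian_iff,
    sum_smul_eq_parametricWeights hn hm φ ψ x y y' hσ hβ hγ z' hA]

omit hγ hm in
theorem evalAt_of_gPosterior_isMAP (v : Vec n → Vec q)
    (hv : ∀ z, IsMAP (gPosterior (multivariateGaussian (0 : Vec q) (β ^ 2 • 1)) (linFun ψ) y σ z)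
      (v z)) :
    (∀ w' : Vec p, v (evalAt (linFun φ) x w') =
      firstStage φ ψ x y (σ ^ 2 / (n * β ^ 2)) w') ∧
    ∀ z, evalAt (linFun ψ) y' (v z) = WithLp.toLp 2 (Aᵀ *ᵥ z.ofLp) := by
  have hn' : (0 : ℝ) < n := Nat.cast_pos.2 hn
  have h1 : (n : ℝ) * (σ ^ 2 / (n * β ^ 2)) = σ ^ 2 / β ^ 2 := by field_simp
  have hv' := fun z => (gPosterior_linear_isMAP_iff ψ hβ hσ y z (v z)).1 (hv z)
  refine ⟨fun w' => ?_, fun z => ?_⟩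
  · rw [hv', firstStage, h1]
  · rw [hv', evalAt_sum_smul, Matrix.mulVec_mulVec, hA, linear_transformation_eq_gram_inner ψ (by positivity),
      Matrix.transpose_mul, Matrix.transpose_nonsing_inv, Matrix.transpose_add,
      gram_inner_transpose, gram_inner_transpose, Matrix.transpose_smul, Matrix.transpose_one]

theorem linear_isTTRR_iff (v : Vec n → Vec q)
    (hv : ∀ z, IsMAP (gPosterior (multivariateGaussian (0 : Vec q) (β ^ 2 • 1)) (linFun ψ) y σ z)
      (v z)) (z' : Vec m) (w : Vec p) :
    IsTTRR φ ψ x y y' (σ ^ 2 / (n * β ^ 2)) (σ ^ 2 / (m * γ ^ 2)) z'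
        (fun w' => v (evalAt (linFun φ) x w')) w ↔
      w = parametricWeights φ ψ x y y' (σ ^ 2 / (n * β ^ 2)) (σ ^ 2 / (m * γ ^ 2)) z' := by
  have hn' : (0 : ℝ) < n := Nat.cast_pos.2 hn
  have hm' : (0 : ℝ) < m := Nat.cast_pos.2 hm
  rw [isTTRR_iff hn hm φ ψ x y y' (by positivity) (by positivity),
    sum_nonparametricWeights_eq_parametricWeights φ ψ x y y' (by positivity) (by positivity)]
  exact and_iff_right (evalAt_of_gPosterior_isMAP hn φ ψ x y y' hσ hβ hA v hv).1

end LinearModel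

/-! ### Kernel models -/

section Kernel

variable {X Y : Type*} {n m : ℕ}

theorem nonparametricWeights_eq (hn : 0 < n) (hm : 0 < m) (k : X → X → ℝ) (ℓ : Y → Y → ℝ)
    (x : Fin n → X) (y : Fin n → Y) (y' : Fin m → Y) (σ : ℝ) (z' : Vec m)
    {A : Matrix (Fin n) (Fin m) ℝ} (hA : A = (gram ℓ y y + σ ^ 2 • 1)⁻¹ * gram ℓ y y') :
    nonparametricWeights k ℓ x y y' (σ ^ 2 / n) (σ ^ 2 / m) z' =
      (A * (Aᵀ * gram k x x * A + σ ^ 2 • 1)⁻¹) *ᵥ z'.ofLp := by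
  have hn' : (n : ℝ) ≠ 0 := Nat.cast_ne_zero.2 hn.ne'
  have hm' : (m : ℝ) ≠ 0 := Nat.cast_ne_zero.2 hm.ne'
  simp only [nonparametricWeights]
  rw [mul_div_cancel₀ _ hn', mul_div_cancel₀ _ hm', ← hA]

variable {Ω : Type*} [MeasurableSpace Ω] {P : Measure Ω} [IsProbabilityMeasure P]

theorem gPosterior_map_isMAP_iff {ℓ : Y → Y → ℝ} {G : Y → Ω → ℝ} (hG : IsCenteredGP ℓ G P)
    {σ : ℝ} (hσ : 0 < σ) (y : Fin n → Y) (y' : Fin m → Y) (z : Vec n) (u : Vec m) :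
    IsMAP ((gPosterior P G y σ z).map (evalAt G y')) u ↔
      u = WithLp.toLp 2 (((gram ℓ y y + σ ^ 2 • 1)⁻¹ * gram ℓ y y')ᵀ *ᵥ z.ofLp) := by
  rw [gPosterior_map hG y hσ, isMAP_multivariateGaussian_iff, Matrix.transpose_mul,
    Matrix.transpose_nonsing_inv, Matrix.transpose_add, hG.gram_transpose, hG.gram_transpose,
    Matrix.transpose_smul, Matrix.transpose_one]

theorem posterior_map_isMAP_iff (hn : 0 < n) (hm : 0 < m) {k : X → X → ℝ} {F : X → Ω → ℝ}
    (hF : IsCenteredGP k F P) (ℓ : Y → Y → ℝ) (x : Fin n → X) (y : Fin n → Y) (y' : Fin m → Y)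
    {σ : ℝ} (hσ : 0 < σ) (z' : Vec m)
    {A : Matrix (Fin n) (Fin m) ℝ} (hA : A = (gram ℓ y y + σ ^ 2 • 1)⁻¹ * gram ℓ y y')
    {d : ℕ} (t : Fin d → X) (u : Vec d) :
    IsMAP (((transformedModel P F x A (σ ^ 2 • 1)).posterior z').map (evalAt F t)) u ↔
      ∀ i, u i = nonparametricDME k ℓ x y y' (σ ^ 2 / n) (σ ^ 2 / m) z' (t i) := by
  rw [transformedModel_posterior_map hF x (posDef_sq_smul_one hσ m),
    isMAP_multivariateGaussian_iff, Matrix.mul_assoc, ← Matrix.mulVec_mulVec,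
    ← nonparametricWeights_eq hn hm k ℓ x y y' σ z' hA]
  have h1 : ∀ i, nonparametricDME k ℓ x y y' (σ ^ 2 / n) (σ ^ 2 / m) z' (t i) =
      (gram k t x *ᵥ nonparametricWeights k ℓ x y y' (σ ^ 2 / n) (σ ^ 2 / m) z') i := by
    intro i
    simp only [nonparametricDME, Matrix.mulVec, dotProduct, gram, Matrix.of_apply]
    refine Finset.sum_congr rfl fun j _ => ?_
    rw [hF.kernel_symm, mul_comm]
  simp_rw [h1]
  constructor
  · rintro rfl i
    rfl
  · intro h
    ext i
    exact h i

theorem kernel_predictive (hn : 0 < n) (hm : 0 < m) {k : X → X → ℝ} {F : X → Ω → ℝ}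
    (hF : IsCenteredGP k F P) (ℓ : Y → Y → ℝ) (x : Fin n → X) (y : Fin n → Y) (y' : Fin m → Y)
    {σ : ℝ} (hσ : 0 < σ) (z' : Vec m)
    {A : Matrix (Fin n) (Fin m) ℝ} (hA : A = (gram ℓ y y + σ ^ 2 • 1)⁻¹ * gram ℓ y y') (t : X) :
    IsProbabilityMeasure ((transformedModel P F x A (σ ^ 2 • 1)).predictive F t z') ∧
    Integrable id ((transformedModel P F x A (σ ^ 2 • 1)).predictive F t z') ∧
    ∫ s, s ∂((transformedModel P F x A (σ ^ 2 • 1)).predictive F t z') =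
      nonparametricDME k ℓ x y y' (σ ^ 2 / n) (σ ^ 2 / m) z' t := by
  rw [nonparametricDME, nonparametricWeights_eq hn hm k ℓ x y y' σ z' hA]
  exact transformedModel_predictive hF x (posDef_sq_smul_one hσ m) z' t

/-- Since Q = σ² (Aᵀ K A + σ² I)⁻¹, both formulas are the density of N(0, Aᵀ K A + σ² I), the second
one with its determinant reduced to size n. -/
theorem kernel_evidence {k : X → X → ℝ} {F : X → Ω → ℝ}
    (hF : IsCenteredGP k F P) (x : Fin n → X) {σ : ℝ} (hσ : 0 < σ) (A : Matrix (Fin n) (Fin m) ℝ)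
    {K B : Matrix (Fin n) (Fin n) ℝ} {Q : Matrix (Fin m) (Fin m) ℝ} (hK : K = gram k x x)
    (hB : B = K * A * Aᵀ + σ ^ 2 • 1) (hQ : Q = 1 - Aᵀ * B⁻¹ * K * A) :
    IsUnit B ∧ Q.PosDef ∧ ∀ z' : Vec m,
      (transformedModel P F x A (σ ^ 2 • 1)).evidence z' = gaussPDF 0 (σ ^ 2 • Q⁻¹) z' ∧
      (transformedModel P F x A (σ ^ 2 • 1)).evidence z' = ENNReal.ofReal
          ((Real.sqrt ((2 * Real.pi) ^ m * ((σ ^ 2) ^ m / (σ ^ 2) ^ n * B.det)))⁻¹ *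
            Real.exp (-(1 / (2 * σ ^ 2)) * (z'.ofLp ⬝ᵥ z'.ofLp -
              (A *ᵥ z'.ofLp) ⬝ᵥ (B⁻¹ *ᵥ (K *ᵥ (A *ᵥ z'.ofLp)))))) := by
  have hc : 0 < σ ^ 2 := by positivity
  have hG := hF.posDef_add x A (posDef_sq_smul_one hσ m)
  have hdet := det_transpose_mul_mul_add K A hc
  rw [← hK] at hG
  rw [← hB] at hdet
  have hQG : Q = σ ^ 2 • (Aᵀ * K * A + σ ^ 2 • 1)⁻¹ := by
    rw [hQ, hB, one_sub_eq_smul_inv hc hG]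
  have hQi : σ ^ 2 • Q⁻¹ = Aᵀ * K * A + σ ^ 2 • 1 := by
    have h1 : Q⁻¹ = (σ ^ 2)⁻¹ • (Aᵀ * K * A + σ ^ 2 • 1) := by
      apply Matrix.inv_eq_right_inv
      rw [hQG, Matrix.smul_mul, Matrix.mul_smul, smul_smul, mul_inv_cancel₀ hc.ne', one_smul,
        Matrix.nonsing_inv_mul _ hG.isUnit_det']
    rw [h1, smul_smul, mul_inv_cancel₀ hc.ne', one_smul]
  have hev : ∀ z', (transformedModel P F x A (σ ^ 2 • 1)).evidence z' =
      gaussPDF 0 (Aᵀ * K * A + σ ^ 2 • 1) z' := fun z' => by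
    rw [transformedModel_evidence hF x (posDef_sq_smul_one hσ m), hK]
  refine ⟨hB ▸ isUnit_mul_mul_transpose_add hc hG, hQG ▸ hG.inv.smul hc, fun z' => ⟨?_, ?_⟩⟩
  · rw [hev, hQi]
  · rw [hev, gaussPDF, hdet, sub_zero]
    have hGi : (Aᵀ * K * A + σ ^ 2 • 1)⁻¹ = (σ ^ 2)⁻¹ • Q := by
      rw [hQG, smul_smul, inv_mul_cancel₀ hc.ne', one_smul]
    have hq : z'.ofLp ⬝ᵥ Q *ᵥ z'.ofLp = z'.ofLp ⬝ᵥ z'.ofLp -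
        (A *ᵥ z'.ofLp) ⬝ᵥ (B⁻¹ *ᵥ (K *ᵥ (A *ᵥ z'.ofLp))) := by
      rw [hQ, Matrix.sub_mulVec, Matrix.one_mulVec, dotProduct_sub, ← Matrix.mulVec_mulVec,
        ← Matrix.mulVec_mulVec, ← Matrix.mulVec_mulVec, Matrix.dotProduct_mulVec _ Aᵀ,
        Matrix.vecMul_transpose]
    rw [hGi, Matrix.smul_mulVec, dotProduct_smul, hq, smul_eq_mul]
    have hcoef : -(1 / (2 * σ ^ 2)) = -(1 / 2) * (σ ^ 2)⁻¹ := by field_simp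
    rw [hcoef, mul_assoc (-(1 / 2) : ℝ)]

/-- Kernel ridge regression in terms of the kernels. -/
theorem isTTRR_of_kernels (hn : 0 < n) (hm : 0 < m) {H₁ H₂ : Type*} [NormedAddCommGroup H₁]
    [InnerProductSpace ℝ H₁] [NormedAddCommGroup H₂] [InnerProductSpace ℝ H₂]
    {k : X → X → ℝ} {ℓ : Y → Y → ℝ} {φ : X → H₁} {ψ : Y → H₂}
    (hk : ∀ a b, inner ℝ (φ a) (φ b) = k a b) (hℓ : ∀ a b, inner ℝ (ψ a) (ψ b) = ℓ a b)
    (x : Fin n → X) (y : Fin n → Y) (y' : Fin m → Y) {σ : ℝ} (hσ : 0 < σ) (z' : Vec m)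
    {g : Vec n → Vec m} (hg : ∀ z, g z =
      WithLp.toLp 2 (((gram ℓ y y + σ ^ 2 • 1)⁻¹ * gram ℓ y y')ᵀ *ᵥ z.ofLp)) :
    (∃ vhat w, IsTTRR φ ψ x y y' (σ ^ 2 / n) (σ ^ 2 / m) z' vhat w) ∧
    ∀ vhat w, IsTTRR φ ψ x y y' (σ ^ 2 / n) (σ ^ 2 / m) z' vhat w →
      (∀ w', g (evalAt (linFun φ) x w') = evalAt (linFun ψ) y' (vhat w')) ∧
      w = ∑ i, nonparametricWeights k ℓ x y y' (σ ^ 2 / n) (σ ^ 2 / m) z' i • φ (x i) ∧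
      ∀ (d : ℕ) (t : Fin d → X) (u : Vec d),
        (∀ i, u i = nonparametricDME k ℓ x y y' (σ ^ 2 / n) (σ ^ 2 / m) z' (t i)) ↔
          u = evalAt (linFun φ) t w := by
  obtain rfl : k = fun a b => inner ℝ (φ a) (φ b) := by
    funext a b
    exact (hk a b).symm
  obtain rfl : ℓ = fun a b => inner ℝ (ψ a) (ψ b) := by
    funext a b
    exact (hℓ a b).symm
  have hn' : (0 : ℝ) < n := Nat.cast_pos.2 hn
  have hm' : (0 : ℝ) < m := Nat.cast_pos.2 hm
  have h := isTTRR_iff hn hm φ ψ x y y' (lam := σ ^ 2 / n) (ε := σ ^ 2 / m) (by positivity)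
    (by positivity) z'
  refine ⟨⟨_, _, (h _ _).2 ⟨fun _ => rfl, rfl⟩⟩, fun vhat w hw => ?_⟩
  obtain ⟨h1, h2⟩ := (h _ _).1 hw
  refine ⟨fun w' => ?_, h2, fun d t u => ?_⟩
  · rw [hg, h1, evalAt_firstStage, mul_div_cancel₀ _ hn'.ne']
  · have h3 : ∀ i, nonparametricDME (fun a b => inner ℝ (φ a) (φ b))
        (fun a b => inner ℝ (ψ a) (ψ b)) x y y' (σ ^ 2 / n) (σ ^ 2 / m) z' (t i) =
        evalAt (linFun φ) t w i := by
      intro i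
      simp only [nonparametricDME, evalAt, linFun]
      rw [h2, sum_inner]
      refine Finset.sum_congr rfl fun j _ => ?_
      rw [real_inner_smul_left]
    simp_rw [h3]
    constructor
    · intro h4
      ext i
      exact h4 i
    · rintro rfl i
      rfl

/-- The task-transformed kernel regression is a transformed kernel regression. -/
theorem ttModel_gPredictive_eq {Ω' : Type*} [MeasurableSpace Ω'] (P' : Measure Ω') (F : X → Ω' → ℝ)
    (x : Fin n → X) {ℓ : Y → Y → ℝ} {G : Y → Ω → ℝ} (hG : IsCenteredGP ℓ G P) {σ : ℝ}
    (hσ : 0 < σ) (y : Fin n → Y) (y' : Fin m → Y) :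
    (gram ℓ y' y' + σ ^ 2 • 1 - (gram ℓ y y')ᵀ * (gram ℓ y y + σ ^ 2 • 1)⁻¹ *
      gram ℓ y y').PosDef ∧
    ttModel P' F x (gPredictive P G y y' σ) =
      transformedModel P' F x ((gram ℓ y y + σ ^ 2 • 1)⁻¹ * gram ℓ y y')
        (gram ℓ y' y' + σ ^ 2 • 1 - (gram ℓ y y')ᵀ * (gram ℓ y y + σ ^ 2 • 1)⁻¹ *
          gram ℓ y y') := by
  have h1 : gram ℓ y' y' + σ ^ 2 • 1 - (gram ℓ y y')ᵀ * (gram ℓ y y + σ ^ 2 • 1)⁻¹ * gram ℓ y y' =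
      gram ℓ y' y' - gram ℓ y' y * (gram ℓ y y + σ ^ 2 • 1)⁻¹ * gram ℓ y y' + σ ^ 2 • 1 := by
    rw [hG.gram_transpose]
    abel
  rw [h1]
  refine ⟨.posSemidef_add (hG.posSemidef_schur y hσ y') (posDef_sq_smul_one hσ m),
    ttModel_eq_transformedModel _ _ _ fun z z' => ?_⟩
  rw [gPredictive_eq hG y hσ, Matrix.transpose_mul, Matrix.transpose_nonsing_inv,
    Matrix.transpose_add, hG.gram_transpose, hG.gram_transpose, Matrix.transpose_smul,
    Matrix.transpose_one]

end Kernel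

end TaskTransformed

/-! ### The main theorem -/

theorem mainTheorem2 {X Y Ωf Ωg : Type*} [MeasurableSpace Ωf] [MeasurableSpace Ωg]
    {n m p q : ℕ} (hn : 0 < n) (hm : 0 < m)
    (x : Fin n → X) (y : Fin n → Y) (y' : Fin m → Y)
    {σ β γ : ℝ} (hσ : 0 < σ) (hβ : 0 < β) (hγ : 0 < γ)
    -- linear models: features
    (φ : X → Vec p) (ψ : Y → Vec q)
    -- kernel models: `F ~ GP(0, k)` and `G ~ GP(0, ℓ)`
    (k : X → X → ℝ) (ℓ : Y → Y → ℝ)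
    (Pf : Measure Ωf) [IsProbabilityMeasure Pf] (Pg : Measure Ωg) [IsProbabilityMeasure Pg]
    (F : X → Ωf → ℝ) (G : Y → Ωg → ℝ) (hF : IsCenteredGP k F Pf) (hG : IsCenteredGP ℓ G Pg) :
    let Φ : Matrix (Fin p) (Fin n) ℝ := featureMatrix φ x
    let Ψ : Matrix (Fin q) (Fin n) ℝ := featureMatrix ψ y
    let Ψ' : Matrix (Fin q) (Fin m) ℝ := featureMatrix ψ y'
    let K : Matrix (Fin n) (Fin n) ℝ := gram k x x
    let L : Matrix (Fin n) (Fin n) ℝ := gram ℓ y y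
    let L' : Matrix (Fin n) (Fin m) ℝ := gram ℓ y y'
    let L'' : Matrix (Fin m) (Fin m) ℝ := gram ℓ y' y'
    let R₁ : Matrix (Fin q) (Fin q) ℝ := Ψ * Ψᵀ + (σ ^ 2 / β ^ 2) • 1
    let A₁ : Matrix (Fin n) (Fin m) ℝ := Ψᵀ * R₁⁻¹ * Ψ'
    let S₁ : Matrix (Fin m) (Fin m) ℝ := σ ^ 2 • (Ψ'ᵀ * R₁⁻¹ * Ψ') + σ ^ 2 • 1
    let D₁ : Matrix (Fin p) (Fin p) ℝ := Φ * A₁ * S₁⁻¹ * A₁ᵀ * Φᵀ + (1 / γ ^ 2) • 1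
    let C₁ : Matrix (Fin p) (Fin p) ℝ := D₁⁻¹
    let Q₁ : Matrix (Fin m) (Fin m) ℝ := S₁⁻¹ - S₁⁻¹ * A₁ᵀ * Φᵀ * C₁ * Φ * A₁ * S₁⁻¹
    let R₂ : Matrix (Fin n) (Fin n) ℝ := L + σ ^ 2 • 1
    let A₂ : Matrix (Fin n) (Fin m) ℝ := R₂⁻¹ * L'
    let S₂ : Matrix (Fin m) (Fin m) ℝ := L'' + σ ^ 2 • 1 - L'ᵀ * R₂⁻¹ * L'
    let B₂ : Matrix (Fin n) (Fin n) ℝ := K * A₂ * A₂ᵀ + σ ^ 2 • 1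
    let Q₂ : Matrix (Fin m) (Fin m) ℝ := 1 - A₂ᵀ * B₂⁻¹ * K * A₂
    -- priors on the weights of `f` and of `g` in the linear models
    let Pw := multivariateGaussian (0 : Vec p) (γ ^ 2 • 1)
    let Pv := multivariateGaussian (0 : Vec q) (β ^ 2 • 1)
    -- the task-transformed Bayesian linear and kernel regression models
    let ttblr := ttModel Pw (linFun φ) x (gPredictive Pv (linFun ψ) y y' σ)
    let ttbkr := ttModel Pf F x (gPredictive Pg G y y' σ)
    -- the same models with the posterior for `g` replaced by a point estimate
    let ttblrPoint := fun v : Vec n → Vec q =>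
      ttModel Pw (linFun φ) x (pointPredictive σ fun z => evalAt (linFun ψ) y' (v z))
    let ttbkrPoint := fun g : Vec n → Vec m => ttModel Pf F x (pointPredictive σ g)
    -- MAP estimates for `g`: of its weights, respectively of its values at `y'`
    let gMAPLin := fun v : Vec n → Vec q => ∀ z, IsMAP (gPosterior Pv (linFun ψ) y σ z) (v z)
    let gMAPKer := fun g : Vec n → Vec m =>
      ∀ z, IsMAP ((gPosterior Pg G y σ z).map (evalAt G y')) (g z)
    let lam₁ := σ ^ 2 / (n * β ^ 2)
    let ε₁ := σ ^ 2 / (m * γ ^ 2)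
    let lam₂ := σ ^ 2 / n
    let ε₂ := σ ^ 2 / m
    -- (1)
    (R₁.PosDef ∧ S₁.PosDef ∧ ttblr = transformedModel Pw (linFun φ) x A₁ S₁) ∧
    -- (2)
    (R₂.PosDef ∧ S₂.PosDef ∧ ttbkr = transformedModel Pf F x A₂ S₂) ∧
    -- (3)
    (D₁.PosDef ∧
      Q₁.PosDef ∧
      (∀ z', ttblr.evidence z' = gaussPDF 0 Q₁⁻¹ z') ∧
      (A₂ᵀ * K * A₂ + S₂).PosDef ∧
      (∀ z', ttbkr.evidence z' = gaussPDF 0 (A₂ᵀ * K * A₂ + S₂) z')) ∧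
    -- (4), linear model
    ((∃ v, gMAPLin v) ∧ ∀ v, gMAPLin v →
      ttblrPoint v = transformedModel Pw (linFun φ) x A₁ (σ ^ 2 • 1) ∧
      ∀ z' t,
        IsProbabilityMeasure ((ttblrPoint v).predictive (linFun φ) t z') ∧
        Integrable id ((ttblrPoint v).predictive (linFun φ) t z') ∧
        ∫ s, s ∂((ttblrPoint v).predictive (linFun φ) t z') =
          parametricDME φ ψ x y y' lam₁ ε₁ z' t) ∧
    -- (4), kernel model, with the alternative marginal likelihood; the last formula evaluates it
    -- through an inverse and a determinant of size `n` only
    ((∃ g, gMAPKer g) ∧ ∀ g, gMAPKer g →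
      ttbkrPoint g = transformedModel Pf F x A₂ (σ ^ 2 • 1) ∧
      (∀ z' t,
        IsProbabilityMeasure ((ttbkrPoint g).predictive F t z') ∧
        Integrable id ((ttbkrPoint g).predictive F t z') ∧
        ∫ s, s ∂((ttbkrPoint g).predictive F t z') =
          nonparametricDME k ℓ x y y' lam₂ ε₂ z' t) ∧
      IsUnit B₂ ∧ Q₂.PosDef ∧
      ∀ z',
        (ttbkrPoint g).evidence z' = gaussPDF 0 (σ ^ 2 • Q₂⁻¹) z' ∧
        (ttbkrPoint g).evidence z' = ENNReal.ofReal
          ((Real.sqrt ((2 * Real.pi) ^ m * ((σ ^ 2) ^ m / (σ ^ 2) ^ n * B₂.det)))⁻¹ *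
            Real.exp (-(1 / (2 * σ ^ 2)) * (z'.ofLp ⬝ᵥ z'.ofLp -
              (A₂ *ᵥ z'.ofLp) ⬝ᵥ (B₂⁻¹ *ᵥ (K *ᵥ (A₂ *ᵥ z'.ofLp))))))) ∧
    -- (5), linear model
    (∀ v, gMAPLin v → ∀ z' w,
      (IsMAP ((ttblrPoint v).posterior z') w ↔
        IsTTRR φ ψ x y y' lam₁ ε₁ z' (fun w' => v (evalAt (linFun φ) x w')) w) ∧
      (IsMAP ((ttblrPoint v).posterior z') w ↔
        w = parametricWeights φ ψ x y y' lam₁ ε₁ z')) ∧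
    -- (5), kernel model: the MAP estimate of `f` is considered at arbitrary finitely many points
    (∀ g, gMAPKer g → ∀ z',
      (∀ (d : ℕ) (t : Fin d → X) (u : Vec d),
        IsMAP (((ttbkrPoint g).posterior z').map (evalAt F t)) u ↔
          ∀ i, u i = nonparametricDME k ℓ x y y' lam₂ ε₂ z' (t i)) ∧
      ∀ (H₁ H₂ : Type*) [NormedAddCommGroup H₁] [InnerProductSpace ℝ H₁]
        [NormedAddCommGroup H₂] [InnerProductSpace ℝ H₂] (φk : X → H₁) (ψℓ : Y → H₂),
        (∀ a b, inner ℝ (φk a) (φk b) = k a b) → (∀ a b, inner ℝ (ψℓ a) (ψℓ b) = ℓ a b) →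
        (∃ vhat w, IsTTRR φk ψℓ x y y' lam₂ ε₂ z' vhat w) ∧
        ∀ vhat w, IsTTRR φk ψℓ x y y' lam₂ ε₂ z' vhat w →
          (∀ w', g (evalAt (linFun φk) x w') = evalAt (linFun ψℓ) y' (vhat w')) ∧
          w = ∑ i, nonparametricWeights k ℓ x y y' lam₂ ε₂ z' i • φk (x i) ∧
          ∀ (d : ℕ) (t : Fin d → X) (u : Vec d),
            IsMAP (((ttbkrPoint g).posterior z').map (evalAt F t)) u ↔
              u = evalAt (linFun φk) t w) := by
  intro Φ Ψ Ψ' K L L' L'' R₁ A₁ S₁ D₁ C₁ Q₁ R₂ A₂ S₂ B₂ Q₂ Pw Pv ttblr ttbkr ttblrPoint ttbkrPoint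
    gMAPLin gMAPKer lam₁ ε₁ lam₂ ε₂
  -- The linear models enter as Gaussian processes with kernels γ² ⟪φ, φ⟫ and β² ⟪ψ, ψ⟫; only A₁ and
  -- S₁ have to be translated from feature space.
  have hFl := isCenteredGP_linFun φ γ
  have hGl := isCenteredGP_linFun ψ β
  have hA₁ : A₁ = (gram (fun a b => β ^ 2 * inner ℝ (ψ a) (ψ b)) y y + σ ^ 2 • 1)⁻¹ *
      gram (fun a b => β ^ 2 * inner ℝ (ψ a) (ψ b)) y y' := linear_transformation_eq ψ hβ hσ y y'
  have hS₁ := linear_covariance_eq ψ hβ hσ y y'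
  obtain ⟨hS₁pd, htt₁⟩ := ttModel_gPredictive_eq Pw (linFun φ) x hGl hσ y y'
  rw [← hS₁] at hS₁pd
  rw [← hS₁, ← hA₁] at htt₁
  change S₁.PosDef at hS₁pd
  change ttblr = transformedModel Pw (linFun φ) x A₁ S₁ at htt₁
  obtain ⟨hS₂pd, htt₂⟩ := ttModel_gPredictive_eq Pf F x hG hσ y y'
  change S₂.PosDef at hS₂pd
  change ttbkr = transformedModel Pf F x A₂ S₂ at htt₂
  have hpointLin : ∀ v, gMAPLin v →
      ttblrPoint v = transformedModel Pw (linFun φ) x A₁ (σ ^ 2 • 1) := fun v hv =>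
    ttModel_eq_transformedModel _ _ _ fun z z' => by
      rw [pointPredictive, (evalAt_of_gPosterior_isMAP hn φ ψ x y y' hσ hβ rfl v hv).2]
  have hgMAPKer : ∀ g, gMAPKer g ↔ ∀ z, g z = WithLp.toLp 2 (A₂ᵀ *ᵥ z.ofLp) := fun g =>
    forall_congr' fun z => gPosterior_map_isMAP_iff hG hσ y y' z (g z)
  have hpointKer : ∀ g, gMAPKer g →
      ttbkrPoint g = transformedModel Pf F x A₂ (σ ^ 2 • 1) := fun g hg =>
    ttModel_eq_transformedModel _ _ _ fun z z' => by
      rw [pointPredictive, (hgMAPKer g).1 hg]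
  have hσβ : 0 < σ ^ 2 / β ^ 2 := by positivity
  refine ⟨⟨posDef_mul_transpose_add Ψ hσβ, hS₁pd, htt₁⟩,
    ⟨hG.posDef_gram_add y hσ, hS₂pd, htt₂⟩, ?_, ?_, ?_, ?_, ?_⟩
  · obtain ⟨hD, hW⟩ := woodbury_inv Φ A₁ hS₁pd (c := γ ^ 2) (by positivity)
    have hGpd := hFl.posDef_add x A₁ hS₁pd
    -- The evidence has covariance γ² A₁ᵀ Φᵀ Φ A₁ + S₁; Woodbury identifies its inverse with Q₁, so
    -- inverting Q₁ returns the covariance.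
    have hQ : (A₁ᵀ * gram (fun a b => γ ^ 2 * inner ℝ (φ a) (φ b)) x x * A₁ + S₁)⁻¹ = Q₁ := by
      rw [gram_const_mul_inner]
      exact hW
    refine ⟨hD, hQ ▸ hGpd.inv, fun z' => ?_, hF.posDef_add x A₂ hS₂pd, fun z' => ?_⟩
    · rw [htt₁, transformedModel_evidence hFl x hS₁pd, ← hQ,
        Matrix.nonsing_inv_nonsing_inv _ hGpd.isUnit_det']
    · rw [htt₂, transformedModel_evidence hF x hS₂pd]
  -- The witness is the explicit mode, read off from its characterization by unification.
  · refine ⟨⟨_, fun z => (gPosterior_linear_isMAP_iff ψ hβ hσ y z _).2 rfl⟩, fun v hv =>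
      ⟨hpointLin v hv, fun z' t => ?_⟩⟩
    rw [hpointLin v hv]
    exact linear_predictive hn hm φ ψ x y y' hσ hβ hγ rfl z' t
  · refine ⟨⟨_, (hgMAPKer _).2 fun z => rfl⟩, fun g hg => ⟨hpointKer g hg, fun z' t => ?_, ?_⟩⟩
    · rw [hpointKer g hg]
      exact kernel_predictive hn hm hF ℓ x y y' hσ z' rfl t
    · rw [hpointKer g hg]
      exact kernel_evidence hF x hσ A₂ rfl rfl rfl
  · intro v hv z' w
    have h := linear_posterior_isMAP_iff hn hm φ ψ x y y' hσ hβ hγ (A := A₁) rfl z' w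
    rw [hpointLin v hv]
    exact ⟨h.trans (linear_isTTRR_iff hn hm φ ψ x y y' hσ hβ hγ (A := A₁) rfl v hv z' w).symm, h⟩
  · intro g hg z'
    have h : ∀ (d : ℕ) (t : Fin d → X) (u : Vec d),
        IsMAP (((ttbkrPoint g).posterior z').map (evalAt F t)) u ↔
          ∀ i, u i = nonparametricDME k ℓ x y y' lam₂ ε₂ z' (t i) := fun d t u => by
      rw [hpointKer g hg]
      exact posterior_map_isMAP_iff hn hm hF ℓ x y y' hσ z' rfl t u
    refine ⟨h, fun H₁ H₂ _ _ _ _ φk ψℓ hk hℓ => ?_⟩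
    obtain ⟨h1, h2⟩ := isTTRR_of_kernels hn hm hk hℓ x y y' hσ z' ((hgMAPKer g).1 hg)
    refine ⟨h1, fun vhat w hw => ?_⟩
    obtain ⟨h3, h4, h5⟩ := h2 vhat w hw
    exact ⟨h3, h4, fun d t u => (h d t u).trans (h5 d t u)⟩
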